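/- Let $p>1$, let $\Gamma\subset SL(2,\mathbb R)$ be a discrete (Fuchsian) group acting on the upper half plane $\mathbb H$ by Möbius transformations, and let $S$ be a closed connected orientable smooth surface of genus $p$ with $S=\mathbb H/\Gamma$, i.e. there is a surjective local diffeomorphism $\pi:\mathbb H\to S$ whose fibres are the $\Gamma$-orbits. Suppose that $\Gamma$ has a fundamental domain which in polar coordinates $z=re^{i\theta}$ has the form $$F=\{\rho_0\le r\le\rho_{2p-1},\ \alpha(r)\le\theta\le\pi-\alpha(r)\},\qquad 0<\rho_0<\rho_1<\dots<\rho_{2p-1},\quad 0<\alpha<\tfrac{\pi}{2},$$ where $\alpha$ is $C^\infty$ on each closed interval $[\rho_{k},\rho_{k+1}]$. So $F$ is bounded by $4p$ sides (the arcs in $r=\rho_0$ and $r=\rho_{2p-1}$ and $2p-1$ arcs on each flank) meeting at $4p$ cusp points (corners), namely the points with $r=\rho_k$ and $\theta\in\{\alpha(\rho_k),\pi-\alpha(\rho_k)\}$. Every orbit meets $F$, distinct interior points of $F$ are inequivalent, and the open sides of $F$ are paired (no side with itself) by transformations $T_i\in\Gamma$, $T_i$ mapping $C_{i_1}$ onto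 $C_{i_2}$, with the inverse pairing given by $T_i^{-1}$. Let $$\phi(r,\theta)=\Big(\frac{\pi}{\pi-2\alpha(r)}\,(\theta-\alpha(r)),\ r\Big)$$ be the resulting map of $F$ onto the rectangle $R=[0,\pi]\times[\rho_0,\rho_{2p-1}]$, and let $m_1,\dots,m_{4p}\in R$ be the images of the cusp points. Let $\phi_*$ be the tangent map of $\phi$: at interior points of $F$ it is $\phi_*v=\lim_{t\to0^+}\big(\phi(z+tv)-\phi(z)\big)/t$ (the ordinary derivative off the arcs $r=\rho_k$, on which $\alpha$ may have a kink), and on the open sides it is the derivative of $\phi|_F$. Let $w$ be a vector field on $R$ that is $C^\infty$ on the interior of $R$, that satisfies $w(m_i)=0$ for all $i$, and that satisfies the matching condition $$w\big(\phi(T_i(q))\big)=\phi_*\big((T_i)_*(v)\big)\quad\text{where } \phi_*v=w(\phi(q)),$$ for each $T_i$ and each $q$ in the open side $C_{i_1}$ paired by $T_i$ with $C_{i_2}$. Then there is a unique vector field $V$ on $S$ (a section of $TS$, not assumed continuous) such that for every $z\in F$ the lift $v\in T_z\mathbb H$ of $V$, determined by $\pi_*v=V(\pi(z))$, satisfies $\phi_*v=w(\phi(z))$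 if $z$ is not a cusp point, and $v=0$ if $z$ is a cusp point. This $V$ vanishes at the images of the cusp points, and it is $C^\infty$ at $\pi(z)$ for each interior point $z$ of $F$ with $|z|\ne\rho_0,\dots,\rho_{2p-1}$. -/

import Mathlib

open Set Filter Topology
open scoped Manifold ContDiff MatrixGroups

noncomputable section

/-- The sides of the fundamental domain: one on an inner circle about `0`, one on an outer circle
about `0`, and `n` sides on each flank. -/
inductive PolySide (n : ℕ) : Type
  | bottom : PolySide n
  | top : PolySide n
  | right (k : Fin n) : PolySide n
  | left (k : Fin n) : PolySide n

/-- A region of the upper half plane bounded by two circular arcs about the origin and two flanks,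
mirror images of each other in the imaginary axis. In polar coordinates `(r, θ)` the right flank is
the curve `θ = α r`; it consists of `n` smooth arcs (for instance geodesic arcs) which meet at the
radii `ρ 0 < ρ 1 < ⋯ < ρ n`. The region has `2 * n + 2` sides and `2 * n + 2` corners. -/
structure PolarPolygon (n : ℕ) where
  /-- the radii of the corners -/
  ρ : Fin (n + 1) → ℝ
  /-- the starting angle, as a function of the radius -/
  α : ℝ → ℝ
  ρ_pos : 0 < ρ 0
  ρ_strictMono : StrictMono ρ
  α_pos : ∀ r ∈ Icc (ρ 0) (ρ (Fin.last n)), 0 < α r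
  α_lt : ∀ r ∈ Icc (ρ 0) (ρ (Fin.last n)), α r < Real.pi / 2
  α_smooth : ∀ k : Fin n, ContDiffOn ℝ ∞ α (Icc (ρ k.castSucc) (ρ k.succ))

namespace PolarPolygon

variable {n : ℕ} (P : PolarPolygon n)

/-- The (closed) region `F`. It lies in the upper half plane since `0 < α < π / 2`. -/
def domain : Set ℂ :=
  {z | ‖z‖ ∈ Icc (P.ρ 0) (P.ρ (Fin.last n)) ∧ z.arg ∈ Icc (P.α ‖z‖) (Real.pi - P.α ‖z‖)}

/-- The sides of `F`, without their end points. -/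
def side : PolySide n → Set ℂ
  | .bottom => {z | ‖z‖ = P.ρ 0 ∧ z.arg ∈ Ioo (P.α ‖z‖) (Real.pi - P.α ‖z‖)}
  | .top => {z | ‖z‖ = P.ρ (Fin.last n) ∧ z.arg ∈ Ioo (P.α ‖z‖) (Real.pi - P.α ‖z‖)}
  | .right k => {z | ‖z‖ ∈ Ioo (P.ρ k.castSucc) (P.ρ k.succ) ∧ z.arg = P.α ‖z‖}
  | .left k => {z | ‖z‖ ∈ Ioo (P.ρ k.castSucc) (P.ρ k.succ) ∧ z.arg = Real.pi - P.α ‖z‖}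

/-- The corners ("cusp points") of `F`, i.e. the end points of its sides. -/
def cusps : Set ℂ :=
  {z | ∃ k : Fin (n + 1), ‖z‖ = P.ρ k ∧
    (z.arg = P.α (P.ρ k) ∨ z.arg = Real.pi - P.α (P.ρ k))}

/-- The map `φ (r, θ) = (π / (π - 2 α) * (θ - α), r)`, with `α = α r`, of `F` onto a rectangle. -/
def phi (z : ℂ) : ℝ × ℝ :=
  (Real.pi / (Real.pi - 2 * P.α ‖z‖) * (z.arg - P.α ‖z‖), ‖z‖)

/-- The rectangle `R`. -/
def rect : Set (ℝ × ℝ) :=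
  Icc 0 Real.pi ×ˢ Icc (P.ρ 0) (P.ρ (Fin.last n))

/-- `P.PushesTo z v u`: the tangent map of `φ` at the point `z` of `F` sends `v` to `u`.
* In the interior of `F` the tangent map is the one-sided directional derivative of `φ`. This is the
  usual derivative wherever `φ` is differentiable, that is, off the arcs `‖z‖ = ρ k`, across which
  `α` has a kink; on these arcs it is the velocity with which `φ` maps a curve that leaves `z` with
  velocity `v`.
* On an open side it is the derivative of `φ` as a function on `F`.
* At a corner only the zero vectors correspond to each other. -/
def PushesTo (z v : ℂ) (u : ℝ × ℝ) : Prop :=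
  (z ∈ interior P.domain ∧
    Tendsto (fun t : ℝ => t⁻¹ • (P.phi (z + (t : ℂ) * v) - P.phi z)) (𝓝[>] 0) (𝓝 u)) ∨
  ((∃ s, z ∈ P.side s) ∧
    ∃ L : ℂ →L[ℝ] ℝ × ℝ, HasFDerivWithinAt P.phi L P.domain z ∧ L v = u) ∨
  (z ∈ P.cusps ∧ v = 0 ∧ u = 0)

/-- `F` is a fundamental domain of the group `Γ` of Möbius transformations: every orbit meets `F`,
and no two distinct points of the interior of `F` lie in the same orbit. -/
def IsFundamentalDomainOf (Γ : Subgroup SL(2, ℝ)) : Prop :=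
  (∀ z : UpperHalfPlane, ∃ γ ∈ Γ, ((γ • z : UpperHalfPlane) : ℂ) ∈ P.domain) ∧
  ∀ γ ∈ Γ, ∀ z : UpperHalfPlane, (z : ℂ) ∈ interior P.domain →
    ((γ • z : UpperHalfPlane) : ℂ) ∈ interior P.domain → γ • z = z

/-- The sides of `F` are paired by elements of `Γ`: `T s` maps the side `s` onto the side `σ s`, and
`T (σ s)` is the inverse of `T s`. -/
structure SidePairing (Γ : Subgroup SL(2, ℝ)) where
  σ : PolySide n → PolySide n
  T : PolySide n → SL(2, ℝ)
  σ_invol : ∀ s, σ (σ s) = s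
  σ_ne : ∀ s, σ s ≠ s
  T_mem : ∀ s, T s ∈ Γ
  T_inv : ∀ s, T (σ s) = (T s)⁻¹
  T_maps : ∀ s, ∀ z : UpperHalfPlane,
    (z : ℂ) ∈ P.side s ↔ ((T s • z : UpperHalfPlane) : ℂ) ∈ P.side (σ s)

/-- The tangent map at `z` of the Möbius transformation `g` of the upper half plane. -/
def moebiusTangent (g : SL(2, ℝ)) (z : UpperHalfPlane) (v : ℂ) : ℂ :=
  mfderiv 𝓘(ℝ, ℂ) 𝓘(ℝ, ℂ) (fun z' : UpperHalfPlane => g • z') z v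

/-- The matching condition for a vector field `w` on the rectangle: if `v` is the vector at a point
`q` of the side `s` that `φ_*` sends to `w (φ q)`, then `φ_* (T_* v) = w (φ (T q))`, where `T` is
the side pairing transformation of `s`. -/
def Matches {Γ : Subgroup SL(2, ℝ)} (A : P.SidePairing Γ) (w : ℝ × ℝ → ℝ × ℝ) : Prop :=
  ∀ s, ∀ q : UpperHalfPlane, (q : ℂ) ∈ P.side s → ∀ v : ℂ,
    P.PushesTo q v (w (P.phi q)) →
    P.PushesTo ((A.T s • q : UpperHalfPlane) : ℂ) (moebiusTangent (A.T s) q v)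
      (w (P.phi ((A.T s • q : UpperHalfPlane) : ℂ)))

end PolarPolygon

/-- A closed connected surface `S` has genus `p` (and is orientable) if its first homology group,
the abelianized fundamental group, is free abelian of rank `2 * p`. -/
def HasGenus (S : Type*) [TopologicalSpace S] (p : ℕ) : Prop :=
  ∀ x : S, Nonempty
    (Abelianization (FundamentalGroup S x) ≃* Multiplicative (Fin (2 * p) → ℤ))

/-- The model space of smooth surfaces. -/
abbrev Plane : Type := EuclideanSpace ℝ (Fin 2)

/-- `π` exhibits the smooth surface `S` as the quotient of the upper half plane by `Γ`. -/
structure IsQuotientSurface (Γ : Subgroup SL(2, ℝ)) {S : Type*} [TopologicalSpace S]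
    [ChartedSpace Plane S] (π : UpperHalfPlane → S) : Prop where
  localDiffeo : IsLocalDiffeomorph 𝓘(ℝ, ℂ) 𝓘(ℝ, Plane) ∞ π
  surj : Function.Surjective π
  fibres : ∀ z z' : UpperHalfPlane, π z = π z' ↔ ∃ γ ∈ Γ, γ • z = z'

/-- The vector field `V` on the surface `S` is the one that `w` defines: at each point `z` of `F`,
the lift of `V` to `z` is sent to `w (φ z)` by the tangent map of `φ`. -/
def IsDefinedBy {n : ℕ} (P : PolarPolygon n) {S : Type*} [TopologicalSpace S]
    [ChartedSpace Plane S] (π : UpperHalfPlane → S) (w : ℝ × ℝ → ℝ × ℝ)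
    (V : (x : S) → TangentSpace 𝓘(ℝ, Plane) x) : Prop :=
  ∀ z : UpperHalfPlane, (z : ℂ) ∈ P.domain →
    ∃ v : TangentSpace 𝓘(ℝ, ℂ) z,
      mfderiv 𝓘(ℝ, ℂ) 𝓘(ℝ, Plane) π z v = V (π z) ∧ P.PushesTo z v (w (P.phi z))

end

/-! ### Polar coordinates in the upper half plane -/

/-! The field `V` is obtained by lifting `w` to `F` through `φ_*` and pushing the lift down by `π`.
Three things have to hold.

Unique lifts (`existsUnique_pushesTo`). In polar coordinates `φ_*` is triangular: the radial
component of the image is that of the vector, and once it is known the angular component is found by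
dividing by a positive factor. This works even on the arcs where `α` has a kink and `φ_*` is only
positively homogeneous (`tangentPhi_eq_iff`). On a side, the derivative within `F` is unique because
the inward directions contain an open half plane.

Consistency on orbits. An interior point of `F` is equivalent to no other point of `F`; a point `q`
of a side `s` only to itself and `T s • q` (`smul_eq_or_of_mem_side`); a corner only to corners
(`smul_mem_cusps`). Behind the second fact is `eventually_mem_domain_or`: near `q` the sets `F` and
`(T s)⁻¹ F` cover the plane, because `T s` exchanges the inner and outer halves of a collar of the
side. The matching condition and `π ∘ γ = π` then settle the sides, and at corners all vectors
vanish. Since every orbit meets `F`, this also gives uniqueness of `V`.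

Smoothness. Away from the arcs `‖z‖ = ρ k` the lift is an explicit smooth function
(`contDiffAt_tangentPhiInv`), and a local inverse of `π` carries it to `S` (`contMDiffAt_of_lift`).
-/

theorem arg_mem_Ioo_iff_im_pos {z : ℂ} : z.arg ∈ Ioo 0 Real.pi ↔ 0 < z.im := by
  constructor
  · rintro ⟨h0, h1⟩
    rcases (Complex.arg_nonneg_iff.1 h0.le).lt_or_eq with h | h
    · exact h
    · exfalso
      rcases le_or_gt 0 z.re with hr | hr
      · have : z.arg = 0 := Complex.arg_eq_zero_iff.2 ⟨hr, h.symm⟩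
        linarith
      · have : z.arg = Real.pi := Complex.arg_eq_pi_iff.2 ⟨hr, h.symm⟩
        linarith
  · intro h
    refine ⟨(Complex.arg_nonneg_iff.2 h.le).lt_of_ne fun h0 => ?_,
      (Complex.arg_le_pi z).lt_of_ne fun h0 => ?_⟩
    · exact h.ne (Complex.arg_eq_zero_iff.1 h0.symm).2.symm
    · exact h.ne' (Complex.arg_eq_pi_iff.1 h0).2

theorem mem_slitPlane_of_im_pos {z : ℂ} (h : 0 < z.im) : z ∈ Complex.slitPlane :=
  Or.inr h.ne'

theorem continuousAt_arg_of_im_pos {z : ℂ} (h : 0 < z.im) : ContinuousAt Complex.arg z :=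
  Complex.continuousAt_arg (mem_slitPlane_of_im_pos h)

theorem norm_polar {r : ℝ} (hr : 0 ≤ r) (θ : ℝ) :
    ‖(r : ℂ) * Complex.exp (θ * Complex.I)‖ = r := by
  rw [norm_mul, Complex.norm_exp_ofReal_mul_I, mul_one, Complex.norm_of_nonneg hr]

theorem arg_polar {r θ : ℝ} (hr : 0 < r) (hθ : θ ∈ Ioo 0 Real.pi) :
    ((r : ℂ) * Complex.exp (θ * Complex.I)).arg = θ := by
  rw [Complex.arg_real_mul _ hr, Complex.arg_exp_mul_I, toIocMod_eq_self]
  exact ⟨by linarith [Real.pi_pos, hθ.1], by linarith [hθ.2]⟩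

/-- A box in the coordinates `(‖z‖, arg z - β ‖z‖)`. -/
def polarBox (β : ℝ → ℝ) (a b c d : ℝ) : Set ℂ :=
  {z | ‖z‖ ∈ Ioo a b ∧ z.arg - β ‖z‖ ∈ Ioo c d}

section PolarBox

variable {β : ℝ → ℝ} {a b c d : ℝ}

/-- The bounds on `c + β r` and `d + β r` keep the box away from the branch cut of `arg`. -/
theorem im_pos_of_mem_polarBox (hβ' : ∀ r ∈ Ioo a b, 0 ≤ c + β r ∧ d + β r ≤ Real.pi) {z : ℂ}
    (hz : z ∈ polarBox β a b c d) : 0 < z.im := by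
  obtain ⟨h1, h2⟩ := hz
  have := hβ' _ h1
  exact arg_mem_Ioo_iff_im_pos.1 ⟨by linarith [h2.1], by linarith [h2.2]⟩

theorem isOpen_polarBox (hβ : ContinuousOn β (Ioo a b))
    (hβ' : ∀ r ∈ Ioo a b, 0 ≤ c + β r ∧ d + β r ≤ Real.pi) :
    IsOpen (polarBox β a b c d) := by
  rw [isOpen_iff_mem_nhds]
  intro z hz
  have him := im_pos_of_mem_polarBox hβ' hz
  have h1 : ∀ᶠ y : ℂ in 𝓝 z, ‖y‖ ∈ Ioo a b :=
    continuous_norm.continuousAt.eventually (isOpen_Ioo.mem_nhds hz.1)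
  have h2 : ContinuousAt (fun y : ℂ => y.arg - β ‖y‖) z :=
    (continuousAt_arg_of_im_pos him).sub
      (ContinuousAt.comp (g := β) (hβ.continuousAt (isOpen_Ioo.mem_nhds hz.1))
        continuous_norm.continuousAt)
  filter_upwards [h1, h2.eventually (isOpen_Ioo.mem_nhds hz.2)] with y hy1 hy2
  exact ⟨hy1, hy2⟩

/-- Connectedness of a box is read off from the product of intervals that parametrizes it. -/
theorem polarBox_eq_image (ha : 0 ≤ a)
    (hβ' : ∀ r ∈ Ioo a b, 0 ≤ c + β r ∧ d + β r ≤ Real.pi) :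
    polarBox β a b c d =
      (fun p : ℝ × ℝ => (p.1 : ℂ) * Complex.exp (((p.2 + β p.1 : ℝ) : ℂ) * Complex.I)) ''
        (Ioo a b ×ˢ Ioo c d) := by
  ext z
  constructor
  · rintro ⟨h1, h2⟩
    refine ⟨(‖z‖, z.arg - β ‖z‖), ⟨h1, h2⟩, ?_⟩
    simp only [sub_add_cancel]
    exact Complex.norm_mul_exp_arg_mul_I z
  · rintro ⟨⟨r, s⟩, ⟨h1, h2⟩, rfl⟩
    simp only at h1 h2 ⊢
    have hr : 0 < r := ha.trans_lt h1.1
    have := hβ' _ h1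
    have hn := norm_polar hr.le (s + β r)
    have harg := arg_polar hr (θ := s + β r) ⟨by linarith [h2.1], by linarith [h2.2]⟩
    simp only [polarBox, mem_ofPred_eq, hn, harg, add_sub_cancel_right]
    exact ⟨h1, h2⟩

theorem continuousOn_polar (hβ : ContinuousOn β (Ioo a b)) (t : Set ℝ) : ContinuousOn
    (fun p : ℝ × ℝ => (p.1 : ℂ) * Complex.exp (((p.2 + β p.1 : ℝ) : ℂ) * Complex.I))
    (Ioo a b ×ˢ t) := by
  have h : ContinuousOn (fun p : ℝ × ℝ => p.2 + β p.1) (Ioo a b ×ˢ t) :=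
    continuousOn_snd.add (hβ.comp continuousOn_fst fun p hp => hp.1)
  have h1 : ContinuousOn (fun p : ℝ × ℝ => (p.1 : ℂ)) (Ioo a b ×ˢ t) :=
    Complex.continuous_ofReal.comp_continuousOn continuousOn_fst
  have h2 : ContinuousOn (fun p : ℝ × ℝ => ((p.2 + β p.1 : ℝ) : ℂ)) (Ioo a b ×ˢ t) :=
    Complex.continuous_ofReal.comp_continuousOn h
  exact h1.mul (Complex.continuous_exp.comp_continuousOn (h2.mul continuousOn_const))

theorem isPreconnected_polarBox (ha : 0 ≤ a) (hβ : ContinuousOn β (Ioo a b))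
    (hβ' : ∀ r ∈ Ioo a b, 0 ≤ c + β r ∧ d + β r ≤ Real.pi) :
    IsPreconnected (polarBox β a b c d) := by
  rw [polarBox_eq_image ha hβ']
  exact (isPreconnected_Ioo.prod isPreconnected_Ioo).image _ (continuousOn_polar hβ _)

/-- Small boxes around a point form a neighbourhood basis. -/
theorem exists_polarBox_subset {q : ℂ} (hq : 0 < q.im) (hqr : ‖q‖ ∈ Ioo a b)
    (hβ : ContinuousOn β (Ioo a b)) {N : Set ℂ} (hN : N ∈ 𝓝 q) :
    ∃ ε > 0, a ≤ ‖q‖ - ε ∧ ‖q‖ + ε ≤ b ∧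
      (∀ r ∈ Ioo (‖q‖ - ε) (‖q‖ + ε), 0 ≤ (q.arg - β ‖q‖ - ε) + β r ∧
        (q.arg - β ‖q‖ + ε) + β r ≤ Real.pi) ∧
      polarBox β (‖q‖ - ε) (‖q‖ + ε) (q.arg - β ‖q‖ - ε) (q.arg - β ‖q‖ + ε) ⊆ N := by
  set e : ℝ × ℝ → ℂ :=
    fun p => (p.1 : ℂ) * Complex.exp (((p.2 + β p.1 : ℝ) : ℂ) * Complex.I) with he
  set p₀ : ℝ × ℝ := (‖q‖, q.arg - β ‖q‖) with hp₀
  have hep : e p₀ = q := by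
    simp only [he, hp₀, sub_add_cancel]
    exact Complex.norm_mul_exp_arg_mul_I q
  have hnh : Ioo a b ×ˢ (univ : Set ℝ) ∈ 𝓝 p₀ :=
    (isOpen_Ioo.prod isOpen_univ).mem_nhds ⟨hqr, trivial⟩
  have hcont : ContinuousAt e p₀ := (continuousOn_polar hβ univ).continuousAt hnh
  have hN' : e ⁻¹' N ∈ 𝓝 p₀ := hcont.preimage_mem_nhds (by rwa [hep])
  have hsum : ContinuousAt (fun p : ℝ × ℝ => p.2 + β p.1) p₀ :=
    (continuousOn_snd.add (hβ.comp continuousOn_fst fun p hp => hp.1) :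
      ContinuousOn (fun p : ℝ × ℝ => p.2 + β p.1) (Ioo a b ×ˢ univ)).continuousAt hnh
  have harg : q.arg ∈ Ioo 0 Real.pi := arg_mem_Ioo_iff_im_pos.2 hq
  have hM : (fun p : ℝ × ℝ => p.2 + β p.1) ⁻¹' Ioo 0 Real.pi ∈ 𝓝 p₀ := by
    refine hsum.preimage_mem_nhds (isOpen_Ioo.mem_nhds ?_)
    simpa [hp₀] using harg
  obtain ⟨δ, hδ, hball⟩ := Metric.mem_nhds_iff.1 (inter_mem (inter_mem hN' hM) hnh)
  have hmem : ∀ r s : ℝ, |r - ‖q‖| < δ → |s - (q.arg - β ‖q‖)| < δ →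
      (e (r, s) ∈ N ∧ s + β r ∈ Ioo 0 Real.pi) ∧ r ∈ Ioo a b := by
    intro r s hr hs
    have : (r, s) ∈ Metric.ball p₀ δ := by
      rw [Metric.mem_ball, Prod.dist_eq, max_lt_iff, Real.dist_eq, Real.dist_eq]
      exact ⟨hr, hs⟩
    obtain ⟨⟨h1, h2⟩, h3⟩ := hball this
    exact ⟨⟨h1, h2⟩, h3.1⟩
  -- Half the radius, so that the end points `‖q‖ ± δ / 2` still lie in the ball and `hmem` applies
  -- to them.
  refine ⟨δ / 2, by positivity, ?_, ?_, ?_, ?_⟩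
  · exact (hmem (‖q‖ - δ / 2) (q.arg - β ‖q‖) (by rw [abs_lt]; constructor <;> linarith)
      (by simpa using hδ)).2.1.le
  · exact (hmem (‖q‖ + δ / 2) (q.arg - β ‖q‖) (by rw [abs_lt]; constructor <;> linarith)
      (by simpa using hδ)).2.2.le
  · intro r hr
    have hr' : |r - ‖q‖| < δ := by rw [abs_lt]; constructor <;> linarith [hr.1, hr.2]
    exact ⟨(hmem r _ hr' (by rw [abs_lt]; constructor <;> linarith)).1.2.1.le,
      (hmem r _ hr' (by rw [abs_lt]; constructor <;> linarith)).1.2.2.le⟩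
  · rintro z ⟨h1, h2⟩
    have := (hmem ‖z‖ (z.arg - β ‖z‖) (by rw [abs_lt]; constructor <;> linarith [h1.1, h1.2])
      (by rw [abs_lt]; constructor <;> linarith [h2.1, h2.2])).1.1
    simp only [he, sub_add_cancel] at this
    rwa [Complex.norm_mul_exp_arg_mul_I] at this

end PolarBox

namespace PolarPolygon

variable {n : ℕ} (P : PolarPolygon n)

/-! ### The flank function -/

/-- Otherwise `ρ k ≤ r` propagates by induction to the last radius. The half-open interval contains
a right neighbourhood of `r`, hence yields a right derivative of `α`; `exists_mem_Ioc` serves for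
left derivatives. -/
theorem exists_mem_Ico {r : ℝ} (hr : r ∈ Ico (P.ρ 0) (P.ρ (Fin.last n))) :
    ∃ k : Fin n, r ∈ Ico (P.ρ k.castSucc) (P.ρ k.succ) := by
  by_contra! h
  have : ∀ k : Fin (n + 1), P.ρ k ≤ r := by
    intro k
    induction k using Fin.induction with
    | zero => exact hr.1
    | succ k ih => exact not_lt.1 fun hk => h k ⟨ih, hk⟩
  exact (this (Fin.last n)).not_gt hr.2

theorem exists_mem_Ioc {r : ℝ} (hr : r ∈ Ioc (P.ρ 0) (P.ρ (Fin.last n))) :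
    ∃ k : Fin n, r ∈ Ioc (P.ρ k.castSucc) (P.ρ k.succ) := by
  by_contra! h
  have : ∀ k : Fin (n + 1), P.ρ k < r := by
    intro k
    induction k using Fin.induction with
    | zero => exact hr.1
    | succ k ih => exact not_le.1 fun hk => h k ⟨ih, hk⟩
  exact (this (Fin.last n)).not_ge hr.2

theorem Icc_subset (k : Fin n) :
    Icc (P.ρ k.castSucc) (P.ρ k.succ) ⊆ Icc (P.ρ 0) (P.ρ (Fin.last n)) :=
  Icc_subset_Icc (P.ρ_strictMono.monotone (Fin.zero_le _)) (P.ρ_strictMono.monotone (Fin.le_last _))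

theorem ρ_mem (k : Fin (n + 1)) : P.ρ k ∈ Icc (P.ρ 0) (P.ρ (Fin.last n)) :=
  ⟨P.ρ_strictMono.monotone (Fin.zero_le _), P.ρ_strictMono.monotone (Fin.le_last _)⟩

theorem exists_hasDerivWithinAt_Ici {r : ℝ} (hr : r ∈ Ico (P.ρ 0) (P.ρ (Fin.last n))) :
    ∃ a, HasDerivWithinAt P.α a (Ici r) r := by
  obtain ⟨k, hk⟩ := P.exists_mem_Ico hr
  have h := ((P.α_smooth k).differentiableOn (by simp) r ⟨hk.1, hk.2.le⟩).hasDerivWithinAt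
  refine ⟨_, h.mono_of_mem_nhdsWithin ?_⟩
  exact mem_of_superset (Icc_mem_nhdsGE hk.2) (Icc_subset_Icc_left hk.1)

theorem exists_hasDerivWithinAt_Iic {r : ℝ} (hr : r ∈ Ioc (P.ρ 0) (P.ρ (Fin.last n))) :
    ∃ a, HasDerivWithinAt P.α a (Iic r) r := by
  obtain ⟨k, hk⟩ := P.exists_mem_Ioc hr
  have h := ((P.α_smooth k).differentiableOn (by simp) r ⟨hk.1.le, hk.2⟩).hasDerivWithinAt
  refine ⟨_, h.mono_of_mem_nhdsWithin ?_⟩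
  exact mem_of_superset (Icc_mem_nhdsLE hk.1) (Icc_subset_Icc_right hk.2)

theorem contDiffAt_α {k : Fin n} {r : ℝ} (hr : r ∈ Ioo (P.ρ k.castSucc) (P.ρ k.succ)) :
    ContDiffAt ℝ ∞ P.α r :=
  (P.α_smooth k).contDiffAt (Icc_mem_nhds hr.1 hr.2)

/-- One-sided derivatives give one-sided continuity, and the two sides glue; at an extreme radius
the missing side is a single point. -/
theorem continuousOn_α : ContinuousOn P.α (Icc (P.ρ 0) (P.ρ (Fin.last n))) := by
  intro r hr
  have h1 : ContinuousWithinAt P.α (Icc (P.ρ 0) (P.ρ (Fin.last n)) ∩ Iic r) r := by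
    rcases hr.1.lt_or_eq with h | h
    · obtain ⟨a, ha⟩ := P.exists_hasDerivWithinAt_Iic ⟨h, hr.2⟩
      exact ha.continuousWithinAt.mono inter_subset_right
    · refine (continuousWithinAt_singleton (x := r)).mono ?_
      rintro x ⟨hx, hx'⟩
      exact le_antisymm hx' (h ▸ hx.1)
  have h2 : ContinuousWithinAt P.α (Icc (P.ρ 0) (P.ρ (Fin.last n)) ∩ Ici r) r := by
    rcases hr.2.lt_or_eq with h | h
    · obtain ⟨a, ha⟩ := P.exists_hasDerivWithinAt_Ici ⟨hr.1, h⟩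
      exact ha.continuousWithinAt.mono inter_subset_right
    · refine (continuousWithinAt_singleton (x := r)).mono ?_
      rintro x ⟨hx, hx'⟩
      exact le_antisymm (h ▸ hx.2) hx'
  refine (h1.union h2).mono ?_
  rw [← inter_union_distrib_left, Iic_union_Ici, inter_univ]

/-! ### The region, its interior, sides and corners -/

theorem norm_pos_of_mem {z : ℂ} (hz : z ∈ P.domain) : 0 < ‖z‖ := P.ρ_pos.trans_le hz.1.1

theorem im_pos {z : ℂ} (hz : z ∈ P.domain) : 0 < z.im := by
  have := P.α_pos _ hz.1
  exact arg_mem_Ioo_iff_im_pos.1 ⟨by linarith [hz.2.1], by linarith [hz.2.2]⟩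

theorem side_subset (s : PolySide n) : P.side s ⊆ P.domain := by
  intro z hz
  cases s with
  | bottom => exact ⟨hz.1 ▸ P.ρ_mem 0, Ioo_subset_Icc_self hz.2⟩
  | top => exact ⟨hz.1 ▸ P.ρ_mem (Fin.last n), Ioo_subset_Icc_self hz.2⟩
  | right k =>
    have h := P.Icc_subset k (Ioo_subset_Icc_self hz.1)
    have := P.α_lt _ h
    exact ⟨h, hz.2.ge, by rw [hz.2]; linarith⟩
  | left k =>
    have h := P.Icc_subset k (Ioo_subset_Icc_self hz.1)
    have := P.α_lt _ h
    exact ⟨h, by rw [hz.2]; linarith, hz.2.le⟩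

theorem cusps_subset : P.cusps ⊆ P.domain := by
  rintro z ⟨k, hk, h⟩
  have hm : ‖z‖ ∈ Icc (P.ρ 0) (P.ρ (Fin.last n)) := hk ▸ P.ρ_mem k
  have := P.α_lt _ hm
  rw [← hk] at h
  rcases h with h | h
  · exact ⟨hm, h.ge, by rw [h]; linarith⟩
  · exact ⟨hm, by rw [h]; linarith, h.le⟩

theorem continuousWithinAt_α_norm {z : ℂ} (hz : z ∈ P.domain) :
    ContinuousWithinAt (fun y : ℂ => P.α ‖y‖) {y | ‖y‖ ∈ Icc (P.ρ 0) (P.ρ (Fin.last n))} z :=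
  ContinuousWithinAt.comp (t := Icc (P.ρ 0) (P.ρ (Fin.last n))) (P.continuousOn_α _ hz.1)
    continuous_norm.continuousWithinAt fun _ hy => hy

theorem eventually_lt_arg {z : ℂ} (hz : z ∈ P.domain) (h : P.α ‖z‖ < z.arg) :
    ∀ᶠ y : ℂ in 𝓝 z, ‖y‖ ∈ Icc (P.ρ 0) (P.ρ (Fin.last n)) → P.α ‖y‖ < y.arg :=
  eventually_nhdsWithin_iff.1 <| (P.continuousWithinAt_α_norm hz).eventually_lt
    (continuousAt_arg_of_im_pos (P.im_pos hz)).continuousWithinAt h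

theorem eventually_arg_lt {z : ℂ} (hz : z ∈ P.domain) (h : z.arg < Real.pi - P.α ‖z‖) :
    ∀ᶠ y : ℂ in 𝓝 z, ‖y‖ ∈ Icc (P.ρ 0) (P.ρ (Fin.last n)) → y.arg < Real.pi - P.α ‖y‖ :=
  eventually_nhdsWithin_iff.1 <|
    (continuousAt_arg_of_im_pos (P.im_pos hz)).continuousWithinAt.eventually_lt
    (continuousWithinAt_const.sub (P.continuousWithinAt_α_norm hz)) h

/-- For the strict inequalities, an interior point is scaled by `1 ± t` and rotated by `± t`: all
four points stay in the region for small `t > 0`, and rotation does not change `α ‖z‖`. -/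
theorem mem_interior_iff {z : ℂ} : z ∈ interior P.domain ↔
    ‖z‖ ∈ Ioo (P.ρ 0) (P.ρ (Fin.last n)) ∧ z.arg ∈ Ioo (P.α ‖z‖) (Real.pi - P.α ‖z‖) := by
  constructor
  · intro hz
    have hzF := interior_subset hz
    have hev : ∀ᶠ y in 𝓝 z, y ∈ P.domain := mem_interior_iff_mem_nhds.1 hz
    have hr := P.norm_pos_of_mem hzF
    have him := P.im_pos hzF
    have harg := arg_mem_Ioo_iff_im_pos.2 him
    have hscale : Tendsto (fun t : ℝ => ((1 + t : ℝ) : ℂ) * z) (𝓝 0) (𝓝 z) := by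
      have : Continuous (fun t : ℝ => ((1 + t : ℝ) : ℂ) * z) := by fun_prop
      simpa using this.tendsto 0
    have hrot : Tendsto (fun t : ℝ => (‖z‖ : ℂ) * Complex.exp (((z.arg + t : ℝ) : ℂ) * Complex.I))
        (𝓝 0) (𝓝 z) := by
      have : Continuous
          (fun t : ℝ => (‖z‖ : ℂ) * Complex.exp (((z.arg + t : ℝ) : ℂ) * Complex.I)) := by
        fun_prop
      have h := this.tendsto 0
      simp only [add_zero] at h
      rwa [Complex.norm_mul_exp_arg_mul_I] at h
    have hneg : Tendsto (fun t : ℝ => -t) (𝓝 0) (𝓝 0) := by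
      simpa using continuous_neg.tendsto (0 : ℝ)
    have hsmall : ∀ᶠ t : ℝ in 𝓝 0, |t| < 1 ∧ |t| < z.arg ∧ |t| < Real.pi - z.arg := by
      have h := (continuous_abs.tendsto (0 : ℝ))
      rw [abs_zero] at h
      filter_upwards [h.eventually_lt_const one_pos, h.eventually_lt_const harg.1,
        h.eventually_lt_const (sub_pos.2 harg.2)] with t h1 h2 h3 using ⟨h1, h2, h3⟩
    have hall := ((hscale.eventually hev).and (((hscale.comp hneg).eventually hev).and
      ((hrot.eventually hev).and (((hrot.comp hneg).eventually hev).and hsmall))))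
    obtain ⟨t, ⟨h1, h2, h3, h4, h5, h6, h7⟩, ht⟩ :=
      ((hall.filter_mono (nhdsWithin_le_nhds (s := Ioi (0 : ℝ)))).and
        self_mem_nhdsWithin).exists
    have ht0 : 0 < t := ht
    rw [abs_of_pos ht0] at h5 h6 h7
    simp only [Function.comp_apply] at h2 h4
    have e1 : ‖((1 + t : ℝ) : ℂ) * z‖ = (1 + t) * ‖z‖ := by
      rw [norm_mul, Complex.norm_of_nonneg (by linarith)]
    have e2 : ‖((1 + -t : ℝ) : ℂ) * z‖ = (1 + -t) * ‖z‖ := by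
      rw [norm_mul, Complex.norm_of_nonneg (by linarith)]
    have h1' := h1.1.2
    have h2' := h2.1.1
    have h3' := h3.2.2
    have h4' := h4.2.1
    rw [e1] at h1'
    rw [e2] at h2'
    rw [norm_polar hr.le, arg_polar hr ⟨by linarith [harg.1], by linarith⟩] at h3' h4'
    refine ⟨⟨?_, ?_⟩, ?_, ?_⟩ <;> nlinarith
  · rintro ⟨h1, h2⟩
    have hzF : z ∈ P.domain := ⟨Ioo_subset_Icc_self h1, Ioo_subset_Icc_self h2⟩
    rw [mem_interior_iff_mem_nhds]
    filter_upwards [P.eventually_lt_arg hzF h2.1, P.eventually_arg_lt hzF h2.2,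
      continuous_norm.continuousAt.eventually (isOpen_Ioo.mem_nhds h1)] with y hy1 hy2 hy3
    have := Ioo_subset_Icc_self hy3
    exact ⟨this, (hy1 this).le, (hy2 this).le⟩

theorem mem_domain_cases {z : ℂ} (hz : z ∈ P.domain) :
    z ∈ interior P.domain ∨ (∃ s, z ∈ P.side s) ∨ z ∈ P.cusps := by
  by_cases hc : z ∈ P.cusps
  · exact Or.inr (Or.inr hc)
  -- At the radii `ρ k` only the corners lie on the flanks, so any other point there is on an
  -- extreme arc or in the interior.
  have hc' : ∀ k, ‖z‖ = P.ρ k → z.arg ∈ Ioo (P.α ‖z‖) (Real.pi - P.α ‖z‖) := by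
    intro k hk
    refine ⟨hz.2.1.lt_of_ne fun h => hc ⟨k, hk, Or.inl ?_⟩,
      hz.2.2.lt_of_ne fun h => hc ⟨k, hk, Or.inr ?_⟩⟩
    · rw [← hk, h]
    · rw [← hk, h]
  rcases hz.1.1.lt_or_eq with h0 | h0
  swap
  · exact Or.inr (Or.inl ⟨.bottom, h0.symm, hc' 0 h0.symm⟩)
  rcases hz.1.2.lt_or_eq with h1 | h1
  swap
  · exact Or.inr (Or.inl ⟨.top, h1, hc' _ h1⟩)
  obtain ⟨k, hk⟩ := P.exists_mem_Ico ⟨h0.le, h1⟩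
  rcases hk.1.lt_or_eq with hk0 | hk0
  swap
  · exact Or.inl (P.mem_interior_iff.2 ⟨⟨h0, h1⟩, hc' _ hk0.symm⟩)
  rcases hz.2.1.lt_or_eq with h2 | h2
  swap
  · exact Or.inr (Or.inl ⟨.right k, ⟨hk0, hk.2⟩, h2.symm⟩)
  rcases hz.2.2.lt_or_eq with h3 | h3
  swap
  · exact Or.inr (Or.inl ⟨.left k, ⟨hk0, hk.2⟩, h3⟩)
  exact Or.inl (P.mem_interior_iff.2 ⟨⟨h0, h1⟩, h2, h3⟩)

theorem notMem_interior_of_mem_side {s : PolySide n} {z : ℂ} (hz : z ∈ P.side s) :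
    z ∉ interior P.domain := by
  rw [mem_interior_iff]
  rintro ⟨h1, h2⟩
  cases s with
  | bottom => exact h1.1.ne' hz.1
  | top => exact h1.2.ne hz.1
  | right k => exact h2.1.ne' hz.2
  | left k => exact h2.2.ne hz.2

theorem notMem_interior_of_mem_cusps {z : ℂ} (hz : z ∈ P.cusps) : z ∉ interior P.domain := by
  rw [mem_interior_iff]
  rintro ⟨h1, h2⟩
  obtain ⟨k, hk, h⟩ := hz
  rw [← hk] at h
  rcases h with h | h
  · exact h2.1.ne' h
  · exact h2.2.ne h

theorem ρ_notMem_Ioo (j : Fin (n + 1)) (k : Fin n) :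
    P.ρ j ∉ Ioo (P.ρ k.castSucc) (P.ρ k.succ) := by
  rintro ⟨h1, h2⟩
  rw [P.ρ_strictMono.lt_iff_lt] at h1 h2
  have h1' : (k : ℕ) < j := h1
  have h2' : (j : ℕ) < k + 1 := h2
  omega

theorem notMem_cusps_of_mem_side {s : PolySide n} {z : ℂ} (hz : z ∈ P.side s) :
    z ∉ P.cusps := by
  rintro ⟨k, hk, h⟩
  rw [← hk] at h
  have hr (j : Fin n) : ‖z‖ ∉ Ioo (P.ρ j.castSucc) (P.ρ j.succ) := by
    rw [hk]; exact P.ρ_notMem_Ioo k j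
  cases s with
  | bottom => rcases h with h | h; exacts [hz.2.1.ne' h, hz.2.2.ne h]
  | top => rcases h with h | h; exacts [hz.2.1.ne' h, hz.2.2.ne h]
  | right j => exact hr j hz.1
  | left j => exact hr j hz.1

theorem index_unique {j k : Fin n} {r : ℝ} (hj : r ∈ Ioo (P.ρ j.castSucc) (P.ρ j.succ))
    (hk : r ∈ Ioo (P.ρ k.castSucc) (P.ρ k.succ)) : j = k := by
  have h1 := P.ρ_strictMono.lt_iff_lt.1 (hj.1.trans hk.2)
  have h2 := P.ρ_strictMono.lt_iff_lt.1 (hk.1.trans hj.2)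
  have h1' : (j : ℕ) < k + 1 := h1
  have h2' : (k : ℕ) < j + 1 := h2
  exact Fin.ext (by omega)

theorem arg_notMem_of_right {k : Fin n} {z : ℂ} (hz : z ∈ P.side (.right k)) :
    z ∉ P.side (.left k) := by
  intro h
  have := P.α_lt _ (P.side_subset _ hz).1
  linarith [hz.2, h.2]

/-- For `n = 0` the inner and outer arcs would coincide. -/
theorem side_unique (hn : 0 < n) {s t : PolySide n} {z : ℂ} (hs : z ∈ P.side s)
    (ht : z ∈ P.side t) : s = t := by
  have h0n : P.ρ 0 < P.ρ (Fin.last n) := P.ρ_strictMono (Fin.lt_def.2 (by simpa using hn))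
  have key (j : Fin (n + 1)) (k : Fin n) (h : ‖z‖ = P.ρ j)
      (h' : ‖z‖ ∈ Ioo (P.ρ k.castSucc) (P.ρ k.succ)) : False := by
    rw [h] at h'; exact P.ρ_notMem_Ioo j k h'
  cases s with
  | bottom => cases t with
    | bottom => rfl
    | top => exact absurd (hs.1.symm.trans ht.1) h0n.ne
    | right k => exact (key _ _ hs.1 ht.1).elim
    | left k => exact (key _ _ hs.1 ht.1).elim
  | top => cases t with
    | bottom => exact absurd (ht.1.symm.trans hs.1) h0n.ne
    | top => rfl
    | right k => exact (key _ _ hs.1 ht.1).elim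
    | left k => exact (key _ _ hs.1 ht.1).elim
  | right k => cases t with
    | bottom => exact (key _ _ ht.1 hs.1).elim
    | top => exact (key _ _ ht.1 hs.1).elim
    | right j => rw [P.index_unique hs.1 ht.1]
    | left j =>
      obtain rfl := P.index_unique hs.1 ht.1
      exact (P.arg_notMem_of_right hs ht).elim
  | left k => cases t with
    | bottom => exact (key _ _ ht.1 hs.1).elim
    | top => exact (key _ _ ht.1 hs.1).elim
    | right j =>
      obtain rfl := P.index_unique hs.1 ht.1
      exact (P.arg_notMem_of_right ht hs).elim
    | left j => rw [P.index_unique hs.1 ht.1]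

/-! ### The region is compact and the closure of its interior -/

/-- The point of the region with given coordinates in the rectangle. -/
noncomputable def ofRect (p : ℝ × ℝ) : ℂ :=
  (p.2 : ℂ) * Complex.exp
    (((P.α p.2 + p.1 / Real.pi * (Real.pi - 2 * P.α p.2) : ℝ) : ℂ) * Complex.I)

theorem continuousOn_ofRect : ContinuousOn P.ofRect P.rect := by
  have hα : ContinuousOn (fun p : ℝ × ℝ => P.α p.2) P.rect :=
    P.continuousOn_α.comp continuousOn_snd fun p hp => hp.2
  have h : ContinuousOn
      (fun p : ℝ × ℝ => P.α p.2 + p.1 / Real.pi * (Real.pi - 2 * P.α p.2)) P.rect :=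
    hα.add ((continuousOn_fst.div_const _).mul (continuousOn_const.sub (continuousOn_const.mul hα)))
  have h1 : ContinuousOn (fun p : ℝ × ℝ => (p.2 : ℂ)) P.rect :=
    Complex.continuous_ofReal.comp_continuousOn continuousOn_snd
  exact h1.mul (Complex.continuous_exp.comp_continuousOn
    ((Complex.continuous_ofReal.comp_continuousOn h).mul continuousOn_const))

theorem norm_ofRect {p : ℝ × ℝ} (hp : p ∈ P.rect) : ‖P.ofRect p‖ = p.2 :=
  norm_polar (P.ρ_pos.le.trans hp.2.1) _

theorem arg_ofRect {p : ℝ × ℝ} (hp : p ∈ P.rect) :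
    (P.ofRect p).arg = P.α p.2 + p.1 / Real.pi * (Real.pi - 2 * P.α p.2) := by
  have h0 := P.α_pos _ hp.2
  have h1 := P.α_lt _ hp.2
  have h2 : 0 ≤ p.1 / Real.pi := div_nonneg hp.1.1 Real.pi_pos.le
  have h3 : p.1 / Real.pi ≤ 1 := (div_le_one Real.pi_pos).2 hp.1.2
  refine arg_polar (P.ρ_pos.trans_le hp.2.1) ⟨?_, ?_⟩
  · nlinarith
  · nlinarith

theorem ofRect_mem {p : ℝ × ℝ} (hp : p ∈ P.rect) : P.ofRect p ∈ P.domain := by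
  have h0 := P.α_pos _ hp.2
  have h1 := P.α_lt _ hp.2
  have h2 : 0 ≤ p.1 / Real.pi := div_nonneg hp.1.1 Real.pi_pos.le
  have h3 : p.1 / Real.pi ≤ 1 := (div_le_one Real.pi_pos).2 hp.1.2
  rw [domain, mem_ofPred_eq, P.norm_ofRect hp, P.arg_ofRect hp]
  exact ⟨hp.2, by nlinarith, by nlinarith⟩

theorem interior_rect :
    interior P.rect = Ioo 0 Real.pi ×ˢ Ioo (P.ρ 0) (P.ρ (Fin.last n)) := by
  rw [rect, interior_prod_eq, interior_Icc, interior_Icc]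

theorem ofRect_mem_interior {p : ℝ × ℝ} (hp : p ∈ interior P.rect) :
    P.ofRect p ∈ interior P.domain := by
  have hp' := interior_subset hp
  rw [interior_rect] at hp
  have h1 := P.α_lt _ hp'.2
  have h2 : 0 < p.1 / Real.pi := div_pos hp.1.1 Real.pi_pos
  have h3 : p.1 / Real.pi < 1 := (div_lt_one Real.pi_pos).2 hp.1.2
  rw [mem_interior_iff, P.norm_ofRect hp', P.arg_ofRect hp']
  exact ⟨hp.2, by nlinarith, by nlinarith⟩

theorem phi_mem {z : ℂ} (hz : z ∈ P.domain) : P.phi z ∈ P.rect := by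
  have h1 := P.α_lt _ hz.1
  have hπ := Real.pi_pos
  have h2 : 0 < Real.pi - 2 * P.α ‖z‖ := by linarith
  refine ⟨⟨?_, ?_⟩, hz.1⟩
  · exact mul_nonneg (div_nonneg hπ.le h2.le) (by linarith [hz.2.1])
  · simp only [phi]
    rw [div_mul_eq_mul_div, div_le_iff₀ h2]
    exact mul_le_mul_of_nonneg_left (by linarith [hz.2.2]) hπ.le

theorem phi_mem_interior {z : ℂ} (hz : z ∈ interior P.domain) : P.phi z ∈ interior P.rect := by
  have h1 := P.α_lt _ (interior_subset hz).1
  rw [mem_interior_iff] at hz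
  rw [interior_rect]
  have hπ := Real.pi_pos
  have h2 : 0 < Real.pi - 2 * P.α ‖z‖ := by linarith
  refine ⟨⟨?_, ?_⟩, hz.1⟩
  · exact mul_pos (div_pos hπ h2) (by linarith [hz.2.1])
  · simp only [phi]
    rw [div_mul_eq_mul_div, div_lt_iff₀ h2]
    exact mul_lt_mul_of_pos_left (by linarith [hz.2.2]) hπ

theorem ofRect_phi {z : ℂ} (hz : z ∈ P.domain) : P.ofRect (P.phi z) = z := by
  have h1 := P.α_lt _ hz.1
  have hπ := Real.pi_pos
  have h2 : Real.pi - 2 * P.α ‖z‖ ≠ 0 := by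
    have : 0 < Real.pi - 2 * P.α ‖z‖ := by linarith
    exact this.ne'
  simp only [ofRect, phi]
  have : P.α ‖z‖ + Real.pi / (Real.pi - 2 * P.α ‖z‖) * (z.arg - P.α ‖z‖) / Real.pi *
      (Real.pi - 2 * P.α ‖z‖) = z.arg := by
    have e : Real.pi / (Real.pi - 2 * P.α ‖z‖) * (z.arg - P.α ‖z‖) / Real.pi *
        (Real.pi - 2 * P.α ‖z‖) = z.arg - P.α ‖z‖ := by
      calc _ = Real.pi / (Real.pi - 2 * P.α ‖z‖) * (Real.pi - 2 * P.α ‖z‖) *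
            (z.arg - P.α ‖z‖) / Real.pi := by ring
        _ = _ := by rw [div_mul_cancel₀ _ h2, mul_div_cancel_left₀ _ hπ.ne']
    rw [e]
    ring
  rw [this]
  exact Complex.norm_mul_exp_arg_mul_I z

/-- `ofRect` inverts `φ`; through it compactness and density of the interior pass from the rectangle
to the region. -/
theorem image_ofRect : P.ofRect '' P.rect = P.domain :=
  Subset.antisymm (image_subset_iff.2 fun _ => P.ofRect_mem)
    fun z hz => ⟨P.phi z, P.phi_mem hz, P.ofRect_phi hz⟩

theorem isCompact_domain : IsCompact P.domain := by
  rw [← image_ofRect]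
  exact (isCompact_Icc.prod isCompact_Icc).image_of_continuousOn P.continuousOn_ofRect

/-- For `n = 0` the region is an arc, with empty interior. -/
theorem domain_subset_closure_interior (hn : 0 < n) : P.domain ⊆ closure (interior P.domain) := by
  have h0n : P.ρ 0 < P.ρ (Fin.last n) := P.ρ_strictMono (Fin.lt_def.2 (by simpa using hn))
  have hrect : closure (interior P.rect) = P.rect := by
    rw [interior_rect, closure_prod_eq, closure_Ioo Real.pi_pos.ne, closure_Ioo h0n.ne, rect]
  rw [← image_ofRect]
  have hc : ContinuousOn P.ofRect (closure (interior P.rect)) := by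
    rw [hrect]; exact P.continuousOn_ofRect
  have := hc.image_closure
  rw [hrect] at this
  refine this.trans (closure_mono ?_)
  rw [image_ofRect]
  exact image_subset_iff.2 fun _ => P.ofRect_mem_interior

/-! ### Collars of the sides -/

/-- Each point of an open side has arbitrarily small neighbourhoods which the side separates into
one connected part inside the region and one connected part outside. -/
theorem exists_collar (hn : 0 < n) {s : PolySide n} {q : ℂ} (hq : q ∈ P.side s) {N : Set ℂ}
    (hN : N ∈ 𝓝 q) :
    ∃ B ⊆ N, IsOpen B ∧ q ∈ B ∧ B ⊆ interior P.domain ∪ P.side s ∪ P.domainᶜ ∧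
      IsPreconnected (B ∩ interior P.domain) ∧ IsPreconnected (B \ P.domain) := by
  have h0n : P.ρ 0 < P.ρ (Fin.last n) := P.ρ_strictMono (Fin.lt_def.2 (by simpa using hn))
  have hqF := P.side_subset s hq
  have him := P.im_pos hqF
  have hαq := P.α_lt _ hqF.1
  -- In suitable coordinates a neighbourhood is a box, and its two parts are boxes.
  have main : ∀ (β : ℝ → ℝ) (a b : ℝ), 0 ≤ a → ‖q‖ ∈ Ioo a b → ContinuousOn β (Ioo a b) →
      (∃ M ∈ 𝓝 q, M ⊆ interior P.domain ∪ P.side s ∪ P.domainᶜ ∧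
        ∀ ε > 0, polarBox β (‖q‖ - ε) (‖q‖ + ε) (q.arg - β ‖q‖ - ε) (q.arg - β ‖q‖ + ε) ⊆ M →
        ∀ B, B = polarBox β (‖q‖ - ε) (‖q‖ + ε) (q.arg - β ‖q‖ - ε) (q.arg - β ‖q‖ + ε) →
        (∃ a' b' c' d', ‖q‖ - ε ≤ a' ∧ b' ≤ ‖q‖ + ε ∧ q.arg - β ‖q‖ - ε ≤ c' ∧
          d' ≤ q.arg - β ‖q‖ + ε ∧ B ∩ interior P.domain = polarBox β a' b' c' d') ∧
        (∃ a' b' c' d', ‖q‖ - ε ≤ a' ∧ b' ≤ ‖q‖ + ε ∧ q.arg - β ‖q‖ - ε ≤ c' ∧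
          d' ≤ q.arg - β ‖q‖ + ε ∧ B \ P.domain = polarBox β a' b' c' d')) →
      ∃ B ⊆ N, IsOpen B ∧ q ∈ B ∧ B ⊆ interior P.domain ∪ P.side s ∪ P.domainᶜ ∧
        IsPreconnected (B ∩ interior P.domain) ∧ IsPreconnected (B \ P.domain) := by
    rintro β a b ha hqr hβ ⟨M, hM, hMsub, hparts⟩
    obtain ⟨ε, hε, h1, h2, h3, h4⟩ := exists_polarBox_subset him hqr hβ (inter_mem hN hM)
    have hpre : ∀ a' b' c' d', ‖q‖ - ε ≤ a' → b' ≤ ‖q‖ + ε → q.arg - β ‖q‖ - ε ≤ c' →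
        d' ≤ q.arg - β ‖q‖ + ε → IsPreconnected (polarBox β a' b' c' d') := by
      intro a' b' c' d' ha' hb' hc' hd'
      refine isPreconnected_polarBox (by linarith)
        (hβ.mono (Ioo_subset_Ioo (by linarith) (by linarith))) fun r hr => ?_
      have := h3 r ⟨by linarith [hr.1], by linarith [hr.2]⟩
      exact ⟨by linarith, by linarith⟩
    obtain ⟨⟨a₁, b₁, c₁, d₁, i1, i2, i3, i4, i5⟩, ⟨a₂, b₂, c₂, d₂, j1, j2, j3, j4, j5⟩⟩ :=
      hparts ε hε (h4.trans inter_subset_right) _ rfl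
    refine ⟨_, h4.trans inter_subset_left,
      isOpen_polarBox (hβ.mono (Ioo_subset_Ioo h1 h2)) h3, ?_,
      (h4.trans inter_subset_right).trans hMsub, ?_, ?_⟩
    · refine ⟨⟨?_, ?_⟩, ?_, ?_⟩ <;> linarith
    · rw [i5]; exact hpre _ _ _ _ i1 i2 i3 i4
    · rw [j5]; exact hpre _ _ _ _ j1 j2 j3 j4
  cases s with
  | bottom =>
    -- Polar coordinates already straighten a circular arc, so `β = 0`; the box is cut at the radius
    -- `‖q‖`. The neighbourhood keeps clear of the other sides.
    refine main (fun _ => 0) 0 (P.ρ (Fin.last n)) le_rfl ⟨P.norm_pos_of_mem hqF, hq.1 ▸ h0n⟩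
      continuousOn_const ⟨_, inter_mem (inter_mem (P.eventually_lt_arg hqF hq.2.1)
        (P.eventually_arg_lt hqF hq.2.2)) (continuous_norm.continuousAt.eventually
          (gt_mem_nhds (hq.1 ▸ h0n : ‖q‖ < P.ρ (Fin.last n)))), ?_, ?_⟩
    · rintro y ⟨⟨h1, h2⟩, h3⟩
      simp only [mem_ofPred_eq, mem_union, mem_compl_iff] at h1 h2 h3 ⊢
      rcases lt_trichotomy ‖y‖ (P.ρ 0) with h | h | h
      · exact Or.inr fun hy => (hy.1.1.trans_lt h).false
      · have : ‖y‖ ∈ Icc (P.ρ 0) (P.ρ (Fin.last n)) := by rw [h]; exact P.ρ_mem _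
        exact Or.inl (Or.inr ⟨h, h1 this, h2 this⟩)
      · exact Or.inl (Or.inl (P.mem_interior_iff.2
          ⟨⟨h, h3⟩, h1 ⟨h.le, h3.le⟩, h2 ⟨h.le, h3.le⟩⟩))
    · rintro ε hε hM B rfl
      refine ⟨⟨‖q‖, _, _, _, by linarith, le_rfl, le_rfl, le_rfl, ?_⟩,
        ⟨_, ‖q‖, _, _, le_rfl, by linarith, le_rfl, le_rfl, ?_⟩⟩
      · ext y
        constructor
        · rintro ⟨hy, hy'⟩
          rw [mem_interior_iff] at hy'
          exact ⟨⟨hq.1 ▸ hy'.1.1, hy.1.2⟩, hy.2⟩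
        · intro hy
          have hyB : y ∈ polarBox (fun _ => 0) (‖q‖ - ε) (‖q‖ + ε) (q.arg - 0 - ε)
              (q.arg - 0 + ε) := ⟨⟨by linarith [hy.1.1], hy.1.2⟩, hy.2⟩
          obtain ⟨⟨h1, h2⟩, h3⟩ := hM hyB
          simp only [mem_ofPred_eq] at h1 h2 h3
          have h : P.ρ 0 < ‖y‖ := hq.1 ▸ hy.1.1
          exact ⟨hyB, P.mem_interior_iff.2 ⟨⟨h, h3⟩, h1 ⟨h.le, h3.le⟩, h2 ⟨h.le, h3.le⟩⟩⟩
      · ext y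
        constructor
        · rintro ⟨hy, hy'⟩
          obtain ⟨⟨h1, h2⟩, h3⟩ := hM hy
          simp only [mem_ofPred_eq] at h1 h2 h3
          refine ⟨⟨hy.1.1, not_le.1 fun h => hy' ?_⟩, hy.2⟩
          rw [hq.1] at h
          exact ⟨⟨h, h3.le⟩, (h1 ⟨h, h3.le⟩).le, (h2 ⟨h, h3.le⟩).le⟩
        · intro hy
          refine ⟨⟨⟨hy.1.1, by linarith [hy.1.2]⟩, hy.2⟩, fun h => ?_⟩
          have := hy.1.2
          rw [hq.1] at this
          exact (h.1.1.trans_lt this).false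
  | top =>
    -- The bound `‖q‖ + 1` is arbitrary; it only has to exceed `‖q‖`.
    refine main (fun _ => 0) (P.ρ 0) (‖q‖ + 1) P.ρ_pos.le ⟨hq.1 ▸ h0n, by linarith⟩
      continuousOn_const ⟨_, inter_mem (inter_mem (P.eventually_lt_arg hqF hq.2.1)
        (P.eventually_arg_lt hqF hq.2.2)) (continuous_norm.continuousAt.eventually
          (lt_mem_nhds (hq.1 ▸ h0n : P.ρ 0 < ‖q‖))), ?_, ?_⟩
    · rintro y ⟨⟨h1, h2⟩, h3⟩
      simp only [mem_ofPred_eq, mem_union, mem_compl_iff] at h1 h2 h3 ⊢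
      rcases lt_trichotomy ‖y‖ (P.ρ (Fin.last n)) with h | h | h
      · exact Or.inl (Or.inl (P.mem_interior_iff.2
          ⟨⟨h3, h⟩, h1 ⟨h3.le, h.le⟩, h2 ⟨h3.le, h.le⟩⟩))
      · have : ‖y‖ ∈ Icc (P.ρ 0) (P.ρ (Fin.last n)) := by rw [h]; exact P.ρ_mem _
        exact Or.inl (Or.inr ⟨h, h1 this, h2 this⟩)
      · exact Or.inr fun hy => (hy.1.2.trans_lt h).false
    · rintro ε hε hM B rfl
      refine ⟨⟨_, ‖q‖, _, _, le_rfl, by linarith, le_rfl, le_rfl, ?_⟩,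
        ⟨‖q‖, _, _, _, by linarith, le_rfl, le_rfl, le_rfl, ?_⟩⟩
      · ext y
        constructor
        · rintro ⟨hy, hy'⟩
          rw [mem_interior_iff] at hy'
          exact ⟨⟨hy.1.1, hq.1 ▸ hy'.1.2⟩, hy.2⟩
        · intro hy
          have hyB : y ∈ polarBox (fun _ => 0) (‖q‖ - ε) (‖q‖ + ε) (q.arg - 0 - ε)
              (q.arg - 0 + ε) := ⟨⟨hy.1.1, by linarith [hy.1.2]⟩, hy.2⟩
          obtain ⟨⟨h1, h2⟩, h3⟩ := hM hyB
          simp only [mem_ofPred_eq] at h1 h2 h3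
          have h : ‖y‖ < P.ρ (Fin.last n) := hq.1 ▸ hy.1.2
          exact ⟨hyB, P.mem_interior_iff.2 ⟨⟨h3, h⟩, h1 ⟨h3.le, h.le⟩, h2 ⟨h3.le, h.le⟩⟩⟩
      · ext y
        constructor
        · rintro ⟨hy, hy'⟩
          obtain ⟨⟨h1, h2⟩, h3⟩ := hM hy
          simp only [mem_ofPred_eq] at h1 h2 h3
          refine ⟨⟨not_le.1 fun h => hy' ?_, hy.1.2⟩, hy.2⟩
          rw [hq.1] at h
          exact ⟨⟨h3.le, h⟩, (h1 ⟨h3.le, h⟩).le, (h2 ⟨h3.le, h⟩).le⟩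
        · intro hy
          refine ⟨⟨⟨by linarith [hy.1.1], hy.1.2⟩, hy.2⟩, fun h => ?_⟩
          have := hy.1.1
          rw [hq.1] at this
          exact (h.1.2.trans_lt this).false
  | right k =>
    have hIcc := P.Icc_subset k
    have hρ0 : 0 < P.ρ k.castSucc := P.ρ_pos.trans_le (P.ρ_mem _).1
    have hlt : q.arg < Real.pi - P.α ‖q‖ := by rw [hq.2]; linarith
    have hIoo : ∀ {y : ℂ}, ‖y‖ ∈ Ioo (P.ρ k.castSucc) (P.ρ k.succ) →
        ‖y‖ ∈ Ioo (P.ρ 0) (P.ρ (Fin.last n)) := fun hy =>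
      ⟨(P.ρ_mem _).1.trans_lt hy.1, hy.2.trans_le (P.ρ_mem _).2⟩
    -- Subtracting `α` from the angle turns the flank into the level `0`, where the box is cut.
    refine main P.α (P.ρ k.castSucc) (P.ρ k.succ) hρ0.le hq.1
      (P.continuousOn_α.mono (Ioo_subset_Icc_self.trans hIcc))
      ⟨_, inter_mem (P.eventually_arg_lt hqF hlt)
        (continuous_norm.continuousAt.eventually (isOpen_Ioo.mem_nhds hq.1)), ?_, ?_⟩
    · rintro y ⟨h2, h3⟩
      simp only [mem_ofPred_eq, mem_union, mem_compl_iff] at h2 h3 ⊢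
      have hy := Ioo_subset_Icc_self (hIoo h3)
      rcases lt_trichotomy y.arg (P.α ‖y‖) with h | h | h
      · exact Or.inr fun hy => (hy.2.1.trans_lt h).false
      · exact Or.inl (Or.inr ⟨h3, h⟩)
      · exact Or.inl (Or.inl (P.mem_interior_iff.2 ⟨hIoo h3, h, h2 hy⟩))
    · rintro ε hε hM B rfl
      have hc : q.arg - P.α ‖q‖ = 0 := sub_eq_zero.2 hq.2
      refine ⟨⟨_, _, 0, _, le_rfl, le_rfl, by linarith, le_rfl, ?_⟩,
        ⟨_, _, _, 0, le_rfl, le_rfl, le_rfl, by linarith, ?_⟩⟩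
      · ext y
        constructor
        · rintro ⟨hy, hy'⟩
          rw [mem_interior_iff] at hy'
          exact ⟨hy.1, by linarith [hy'.2.1], hy.2.2⟩
        · intro hy
          have hyB : y ∈ polarBox P.α (‖q‖ - ε) (‖q‖ + ε) (q.arg - P.α ‖q‖ - ε)
              (q.arg - P.α ‖q‖ + ε) := ⟨hy.1, by linarith [hy.2.1], hy.2.2⟩
          obtain ⟨h2, h3⟩ := hM hyB
          simp only [mem_ofPred_eq] at h2 h3
          exact ⟨hyB, P.mem_interior_iff.2 ⟨hIoo h3, by linarith [hy.2.1],
            h2 (Ioo_subset_Icc_self (hIoo h3))⟩⟩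
      · ext y
        constructor
        · rintro ⟨hy, hy'⟩
          obtain ⟨h2, h3⟩ := hM hy
          simp only [mem_ofPred_eq] at h2 h3
          refine ⟨hy.1, hy.2.1, not_le.1 fun h => hy' ?_⟩
          have := Ioo_subset_Icc_self (hIoo h3)
          exact ⟨this, by linarith, (h2 this).le⟩
        · intro hy
          exact ⟨⟨hy.1, hy.2.1, by linarith [hy.2.2]⟩, fun h => by linarith [h.2.1, hy.2.2]⟩
  | left k =>
    have hIcc := P.Icc_subset k
    have hρ0 : 0 < P.ρ k.castSucc := P.ρ_pos.trans_le (P.ρ_mem _).1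
    have hlt : P.α ‖q‖ < q.arg := by rw [hq.2]; linarith
    have hIoo : ∀ {y : ℂ}, ‖y‖ ∈ Ioo (P.ρ k.castSucc) (P.ρ k.succ) →
        ‖y‖ ∈ Ioo (P.ρ 0) (P.ρ (Fin.last n)) := fun hy =>
      ⟨(P.ρ_mem _).1.trans_lt hy.1, hy.2.trans_le (P.ρ_mem _).2⟩
    refine main (fun r => Real.pi - P.α r) (P.ρ k.castSucc) (P.ρ k.succ) hρ0.le hq.1
      (continuousOn_const.sub (P.continuousOn_α.mono (Ioo_subset_Icc_self.trans hIcc)))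
      ⟨_, inter_mem (P.eventually_lt_arg hqF hlt)
        (continuous_norm.continuousAt.eventually (isOpen_Ioo.mem_nhds hq.1)), ?_, ?_⟩
    · rintro y ⟨h2, h3⟩
      simp only [mem_ofPred_eq, mem_union, mem_compl_iff] at h2 h3 ⊢
      have hy := Ioo_subset_Icc_self (hIoo h3)
      rcases lt_trichotomy y.arg (Real.pi - P.α ‖y‖) with h | h | h
      · exact Or.inl (Or.inl (P.mem_interior_iff.2 ⟨hIoo h3, h2 hy, h⟩))
      · exact Or.inl (Or.inr ⟨h3, h⟩)
      · exact Or.inr fun hy => (hy.2.2.trans_lt h).false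
    · rintro ε hε hM B rfl
      have hc : q.arg - (Real.pi - P.α ‖q‖) = 0 := sub_eq_zero.2 hq.2
      refine ⟨⟨_, _, _, 0, le_rfl, le_rfl, le_rfl, by linarith, ?_⟩,
        ⟨_, _, 0, _, le_rfl, le_rfl, by linarith, le_rfl, ?_⟩⟩
      · ext y
        constructor
        · rintro ⟨hy, hy'⟩
          rw [mem_interior_iff] at hy'
          exact ⟨hy.1, hy.2.1, by linarith [hy'.2.2]⟩
        · intro hy
          have hyB : y ∈ polarBox (fun r => Real.pi - P.α r) (‖q‖ - ε) (‖q‖ + ε)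
              (q.arg - (Real.pi - P.α ‖q‖) - ε) (q.arg - (Real.pi - P.α ‖q‖) + ε) :=
            ⟨hy.1, hy.2.1, by linarith [hy.2.2]⟩
          obtain ⟨h2, h3⟩ := hM hyB
          simp only [mem_ofPred_eq] at h2 h3
          exact ⟨hyB, P.mem_interior_iff.2 ⟨hIoo h3, h2 (Ioo_subset_Icc_self (hIoo h3)),
            by linarith [hy.2.2]⟩⟩
      · ext y
        constructor
        · rintro ⟨hy, hy'⟩
          obtain ⟨h2, h3⟩ := hM hy
          simp only [mem_ofPred_eq] at h2 h3
          refine ⟨hy.1, not_le.1 fun h => hy' ?_, hy.2.2⟩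
          have := Ioo_subset_Icc_self (hIoo h3)
          exact ⟨this, (h2 this).le, by linarith⟩
        · intro hy
          exact ⟨⟨hy.1, by linarith [hy.2.1], hy.2.2⟩, fun h => by linarith [h.2.2, hy.2.1]⟩

end PolarPolygon

/-! ### Derivatives of the polar coordinates -/

/-- The differential of `‖z‖`. -/
noncomputable def normDeriv (z : ℂ) : ℂ →L[ℝ] ℝ :=
  ‖z‖ • Complex.reCLM.comp (ContinuousLinearMap.mul ℝ ℂ z⁻¹)

/-- The differential of `arg z`. -/
noncomputable def argDeriv (z : ℂ) : ℂ →L[ℝ] ℝ :=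
  Complex.imCLM.comp (ContinuousLinearMap.mul ℝ ℂ z⁻¹)

theorem normDeriv_apply (z v : ℂ) : normDeriv z v = ‖z‖ * (z⁻¹ * v).re := rfl

theorem argDeriv_apply (z v : ℂ) : argDeriv z v = (z⁻¹ * v).im := rfl

theorem normDeriv_self {z : ℂ} (hz : z ≠ 0) : normDeriv z z = ‖z‖ := by
  rw [normDeriv_apply, inv_mul_cancel₀ hz, Complex.one_re, mul_one]

theorem normDeriv_mul_I {z : ℂ} (hz : z ≠ 0) : normDeriv z (z * Complex.I) = 0 := by
  rw [normDeriv_apply, inv_mul_cancel_left₀ hz, Complex.I_re, mul_zero]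

theorem argDeriv_mul_I {z : ℂ} (hz : z ≠ 0) : argDeriv z (z * Complex.I) = 1 := by
  rw [argDeriv_apply, inv_mul_cancel_left₀ hz, Complex.I_im]

/-- Both polar coordinates come from `log`: its imaginary part is `arg`, and the exponential of its
real part is the norm. -/
theorem hasFDerivAt_log {z : ℂ} (h : 0 < z.im) :
    HasFDerivAt Complex.log (ContinuousLinearMap.mul ℝ ℂ z⁻¹) z := by
  have h1 := (Complex.hasStrictDerivAt_log (mem_slitPlane_of_im_pos h)
    ).hasDerivAt.hasFDerivAt.restrictScalars ℝ
  refine h1.congr_fderiv ?_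
  ext
  simp [mul_comm]

theorem hasFDerivAt_arg {z : ℂ} (h : 0 < z.im) : HasFDerivAt Complex.arg (argDeriv z) z := by
  have h1 := Complex.imCLM.hasFDerivAt.comp z (hasFDerivAt_log h)
  refine h1.congr_of_eventuallyEq (Eventually.of_forall fun y => ?_)
  simp [Complex.log_im]

theorem hasFDerivAt_norm_of_im_pos {z : ℂ} (h : 0 < z.im) :
    HasFDerivAt (fun y : ℂ => ‖y‖) (normDeriv z) z := by
  have hz : z ≠ 0 := fun h0 => by simp [h0] at h
  have h1 := (Complex.reCLM.hasFDerivAt.comp z (hasFDerivAt_log h)).exp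
  have h2 : Real.exp ((Complex.reCLM ∘ Complex.log) z) = ‖z‖ := by
    simp [Complex.log_re, Real.exp_log (norm_pos_iff.2 hz)]
  rw [h2] at h1
  refine h1.congr_of_eventuallyEq ?_
  filter_upwards [isOpen_ne.mem_nhds hz] with y hy
  simp [Complex.log_re, Real.exp_log (norm_pos_iff.2 hy)]

theorem contDiffAt_arg {z : ℂ} (h : 0 < z.im) : ContDiffAt ℝ ∞ Complex.arg z := by
  have h1 : ContDiffAt ℝ ∞ Complex.log z :=
    (Complex.contDiffAt_log (mem_slitPlane_of_im_pos h)).restrict_scalars ℝ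
  have h2 := Complex.imCLM.contDiff.contDiffAt.comp z h1
  refine h2.congr_of_eventuallyEq (Eventually.of_forall fun y => ?_)
  simp [Complex.log_im]

/-! ### One-sided derivatives -/

/-- The positively homogeneous function with slope `a` to the right of `0` and `b` to the left. -/
def kinkDeriv (a b x : ℝ) : ℝ := a * max x 0 - b * max (-x) 0

theorem kinkDeriv_of_nonneg (a b : ℝ) {x : ℝ} (h : 0 ≤ x) : kinkDeriv a b x = a * x := by
  rw [kinkDeriv, max_eq_left h, max_eq_right (by linarith), mul_zero, sub_zero]

theorem kinkDeriv_of_nonpos (a b : ℝ) {x : ℝ} (h : x ≤ 0) : kinkDeriv a b x = b * x := by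
  rw [kinkDeriv, max_eq_right h, max_eq_left (by linarith)]
  ring

theorem kinkDeriv_mul (a b : ℝ) {t : ℝ} (ht : 0 ≤ t) (x : ℝ) :
    kinkDeriv a b (t * x) = t * kinkDeriv a b x := by
  rcases le_total 0 x with h | h
  · rw [kinkDeriv_of_nonneg _ _ (mul_nonneg ht h), kinkDeriv_of_nonneg _ _ h]
    ring
  · rw [kinkDeriv_of_nonpos _ _ (mul_nonpos_of_nonneg_of_nonpos ht h), kinkDeriv_of_nonpos _ _ h]
    ring

theorem continuous_kinkDeriv (a b : ℝ) : Continuous (kinkDeriv a b) := by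
  unfold kinkDeriv
  fun_prop

/-- Chain rule for a function with a kink along a curve which leaves the kink. -/
theorem hasDerivWithinAt_comp_of_kink {f r : ℝ → ℝ} {a b r' : ℝ}
    (ha : HasDerivWithinAt f a (Ici (r 0)) (r 0)) (hb : HasDerivWithinAt f b (Iic (r 0)) (r 0))
    (hr : HasDerivWithinAt r r' (Ioi 0) 0) :
    HasDerivWithinAt (fun t => f (r t)) (kinkDeriv a b r') (Ioi 0) 0 := by
  -- The two one-sided expansions form a single first-order expansion whose principal term is not
  -- linear.
  have h1 : (fun x => f x - f (r 0) - kinkDeriv a b (x - r 0)) =o[𝓝 (r 0)]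
      fun x => x - r 0 := by
    rw [← nhdsLE_sup_nhdsGE, Asymptotics.isLittleO_sup]
    constructor
    · refine (hasDerivWithinAt_iff_isLittleO.1 hb).congr' ?_ EventuallyEq.rfl
      filter_upwards [self_mem_nhdsWithin] with x hx
      rw [kinkDeriv_of_nonpos _ _ (sub_nonpos.2 hx), smul_eq_mul, mul_comm]
    · refine (hasDerivWithinAt_iff_isLittleO.1 ha).congr' ?_ EventuallyEq.rfl
      filter_upwards [self_mem_nhdsWithin] with x hx
      rw [kinkDeriv_of_nonneg _ _ (sub_nonneg.2 hx), smul_eq_mul, mul_comm]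
  have hslope := (hasDerivWithinAt_iff_tendsto_slope' self_notMem_Ioi).1 hr
  have h2 : (fun t => r t - r 0) =O[𝓝[>] 0] fun t => t - 0 := hr.differentiableWithinAt.isBigO_sub
  have h3 := ((h1.comp_tendsto hr.continuousWithinAt).trans_isBigO h2).tendsto_div_nhds_zero
  rw [hasDerivWithinAt_iff_tendsto_slope' self_notMem_Ioi]
  have h4 := h3.add ((continuous_kinkDeriv a b).continuousAt.tendsto.comp hslope)
  rw [zero_add] at h4
  refine h4.congr' ?_
  filter_upwards [self_mem_nhdsWithin] with t ht
  have ht' : (0 : ℝ) < t := ht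
  simp only [Function.comp_apply, slope_def_field, sub_zero]
  -- `kinkDeriv` commutes only with nonnegative factors; here the factor is `t⁻¹`.
  rw [div_eq_inv_mul (r t - r 0), kinkDeriv_mul _ _ (inv_nonneg.2 ht'.le)]
  field_simp
  ring

theorem HasDerivWithinAt.eventually_gt {f : ℝ → ℝ} {f' : ℝ}
    (hf : HasDerivWithinAt f f' (Ioi 0) 0) (h : 0 < f') : ∀ᶠ t in 𝓝[>] (0 : ℝ), f 0 < f t := by
  have := (hasDerivWithinAt_iff_tendsto_slope' self_notMem_Ioi).1 hf
  filter_upwards [this.eventually_const_lt h, self_mem_nhdsWithin] with t h1 ht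
  have ht' : (0 : ℝ) < t := ht
  rw [slope_def_field, sub_zero] at h1
  exact sub_pos.1 ((div_pos_iff_of_pos_right ht').1 h1)

theorem tendsto_add_mul (z v : ℂ) : Tendsto (fun t : ℝ => z + (t : ℂ) * v) (𝓝[>] 0) (𝓝 z) := by
  have h : Continuous fun t : ℝ => z + (t : ℂ) * v := by fun_prop
  have h2 := h.tendsto 0
  simp only [Complex.ofReal_zero, zero_mul, add_zero] at h2
  exact h2.mono_left nhdsWithin_le_nhds

theorem hasDerivWithinAt_line (z v : ℂ) (s : Set ℝ) (t : ℝ) :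
    HasDerivWithinAt (fun t : ℝ => z + (t : ℂ) * v) v s t := by
  have h := ((hasDerivAt_id t).ofReal_comp.mul_const v).const_add z
  simpa using h.hasDerivWithinAt

theorem hasDerivWithinAt_comp_line {E : Type*} [NormedAddCommGroup E] [NormedSpace ℝ E]
    {f : ℂ → E} {L : ℂ →L[ℝ] E} {z : ℂ} (hf : HasFDerivAt f L z) (v : ℂ) :
    HasDerivWithinAt (fun t : ℝ => f (z + (t : ℂ) * v)) (L v) (Ioi 0) 0 := by
  have hf' : HasFDerivAt f L (z + ((0 : ℝ) : ℂ) * v) := by simpa using hf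
  exact hf'.comp_hasDerivWithinAt (0 : ℝ) (hasDerivWithinAt_line z v _ 0)

/-- If a set contains, for an open set of directions, short segments from a point, then derivatives
within the set are unique at that point. -/
theorem uniqueDiffWithinAt_of_eventually_mem {F U : Set ℂ} {z : ℂ} (hz : z ∈ F) (hU : IsOpen U)
    (hne : U.Nonempty) (h : ∀ v ∈ U, ∀ᶠ t : ℝ in 𝓝[>] 0, z + (t : ℂ) * v ∈ F) :
    UniqueDiffWithinAt ℝ F z := by
  refine ⟨?_, subset_closure hz⟩
  have hsub : U ⊆ tangentConeAt ℝ F z := fun v hv =>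
    mem_tangentConeAt_of_add_smul_mem (l := 𝓝[>] (0 : ℝ)) (c := id)
      (tendsto_id'.2 (nhdsGT_le_nhdsNE 0)) (by simpa using h v hv)
  have htop : Submodule.span ℝ (tangentConeAt ℝ F z) = ⊤ := by
    refine Submodule.eq_top_of_nonempty_interior' _ ?_
    obtain ⟨v, hv⟩ := hne
    exact ⟨v, mem_interior_iff_mem_nhds.2 (mem_of_superset (hU.mem_nhds hv)
      (hsub.trans Submodule.subset_span))⟩
  rw [htop]
  exact dense_univ

namespace PolarPolygon

variable {n : ℕ} (P : PolarPolygon n)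

/-! ### The tangent map of `φ` -/

/-- The horizontal scaling factor of `φ` at the radius `r`. -/
noncomputable def stretch (r : ℝ) : ℝ := Real.pi / (Real.pi - 2 * P.α r)

/-- The derivative of the first coordinate of `φ` with respect to the value of `α`, apart from the
contribution of the translation by `α`. -/
noncomputable def shear (z : ℂ) : ℝ :=
  2 * Real.pi / (Real.pi - 2 * P.α ‖z‖) ^ 2 * (z.arg - P.α ‖z‖)

/-- The tangent map of `φ`, where `A` is the tangent map of `α`. -/
noncomputable def tangentPhi (A : ℝ → ℝ) (z v : ℂ) : ℝ × ℝ :=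
  (P.stretch ‖z‖ * (argDeriv z v - A (normDeriv z v)) + P.shear z * A (normDeriv z v),
    normDeriv z v)

/-- The inverse of the tangent map of `φ`, where `A` is the tangent map of `α`. -/
noncomputable def tangentPhiInv (A : ℝ → ℝ) (z : ℂ) (u : ℝ × ℝ) : ℂ :=
  z * (((u.2 / ‖z‖ : ℝ) : ℂ) +
    (((u.1 - P.shear z * A u.2) / P.stretch ‖z‖ + A u.2 : ℝ) : ℂ) * Complex.I)

theorem pi_sub_pos {z : ℂ} (hz : z ∈ P.domain) : 0 < Real.pi - 2 * P.α ‖z‖ := by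
  linarith [P.α_lt _ hz.1]

theorem stretch_pos {z : ℂ} (hz : z ∈ P.domain) : 0 < P.stretch ‖z‖ :=
  div_pos Real.pi_pos (P.pi_sub_pos hz)

/-- The second coordinate fixes the radial part of `v`, hence the value of `A`, and the first
coordinate is then affine in the angular part with slope `stretch > 0`. Nothing is asked of `A`, so
a kink is allowed. -/
theorem tangentPhi_eq_iff (A : ℝ → ℝ) {z : ℂ} (hz : z ∈ P.domain) (v : ℂ) (u : ℝ × ℝ) :
    P.tangentPhi A z v = u ↔ v = P.tangentPhiInv A z u := by
  have hr := P.norm_pos_of_mem hz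
  have hz0 : z ≠ 0 := norm_pos_iff.1 hr
  have hc := (P.stretch_pos hz).ne'
  have hv : v = P.tangentPhiInv A z u ↔ z⁻¹ * v = ((u.2 / ‖z‖ : ℝ) : ℂ) +
    (((u.1 - P.shear z * A u.2) / P.stretch ‖z‖ + A u.2 : ℝ) : ℂ) * Complex.I := by
    rw [tangentPhiInv, ← inv_mul_eq_iff_eq_mul₀ hz0]
  rw [hv, Complex.ext_iff, Prod.ext_iff]
  simp only [tangentPhi, normDeriv_apply, argDeriv_apply]
  generalize z⁻¹ * v = y
  simp only [Complex.add_re, Complex.ofReal_re,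
    Complex.mul_re, Complex.I_re, Complex.ofReal_im, Complex.I_im, Complex.add_im, Complex.mul_im,
    mul_zero, mul_one, zero_add, add_zero, sub_zero]
  constructor
  · rintro ⟨h1, h2⟩
    rw [h2] at h1
    refine ⟨by rw [← h2, mul_div_cancel_left₀ _ hr.ne'], ?_⟩
    rw [← h1, add_sub_cancel_right, mul_div_cancel_left₀ _ hc, sub_add_cancel]
  · rintro ⟨h1, h2⟩
    have h3 : ‖z‖ * y.re = u.2 := by rw [h1, mul_div_cancel₀ _ hr.ne']
    refine ⟨?_, h3⟩
    rw [h3, h2, add_sub_cancel_right, mul_div_cancel₀ _ hc, sub_add_cancel]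

/-- The first coordinate of `φ` as a function of the value of `α` and of the angle. -/
theorem hasFDerivAt_angle {z : ℂ} (hz : z ∈ P.domain) :
    HasFDerivAt (fun p : ℝ × ℝ => Real.pi / (Real.pi - 2 * p.1) * (p.2 - p.1))
      (P.stretch ‖z‖ • (ContinuousLinearMap.snd ℝ ℝ ℝ - ContinuousLinearMap.fst ℝ ℝ ℝ) +
        P.shear z • ContinuousLinearMap.fst ℝ ℝ ℝ) (P.α ‖z‖, z.arg) := by
  have hD := (P.pi_sub_pos hz).ne'
  have h1 : HasDerivAt (fun x : ℝ => Real.pi / (Real.pi - 2 * x))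
      (2 * Real.pi / (Real.pi - 2 * P.α ‖z‖) ^ 2) (P.α ‖z‖) := by
    have h := (hasDerivAt_const (P.α ‖z‖) Real.pi).div
      (((hasDerivAt_id (P.α ‖z‖)).const_mul 2).const_sub Real.pi) hD
    refine h.congr_deriv ?_
    simp
    ring
  have hfst : HasFDerivAt (fun p : ℝ × ℝ => p.1) (ContinuousLinearMap.fst ℝ ℝ ℝ)
    (P.α ‖z‖, z.arg) := hasFDerivAt_fst
  have hsnd : HasFDerivAt (fun p : ℝ × ℝ => p.2) (ContinuousLinearMap.snd ℝ ℝ ℝ)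
    (P.α ‖z‖, z.arg) := hasFDerivAt_snd
  have h2 := (HasDerivAt.comp_hasFDerivAt (P.α ‖z‖, z.arg) h1 hfst).mul (hsnd.sub hfst)
  refine h2.congr_fderiv ?_
  ext <;> simp [stretch, shear]
  ring

/-- The set `s` is the region at points of the sides, and the whole plane at interior points off the
kinks. -/
theorem hasFDerivWithinAt_phi {z : ℂ} (hz : z ∈ P.domain) {a : ℝ} {s : Set ℂ}
    (ha : HasFDerivWithinAt (fun y : ℂ => P.α ‖y‖) (a • normDeriv z) s z) :
    ∃ L : ℂ →L[ℝ] ℝ × ℝ, HasFDerivWithinAt P.phi L s z ∧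
      ∀ v, L v = P.tangentPhi (fun x => a * x) z v := by
  have him := P.im_pos hz
  have h1 := (P.hasFDerivAt_angle hz).comp_hasFDerivWithinAt z
    (f := fun y : ℂ => (P.α ‖y‖, y.arg)) (ha.prodMk (hasFDerivAt_arg him).hasFDerivWithinAt)
  exact ⟨_, h1.prodMk (hasFDerivAt_norm_of_im_pos him).hasFDerivWithinAt, fun v => rfl⟩

/-- `A` is `kinkDeriv` with the right and left slopes of `α`. It does not depend on `v`, so one
inverse formula serves all directions. -/
theorem tendsto_phi_slope {z : ℂ} (hz : z ∈ interior P.domain) :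
    ∃ A : ℝ → ℝ, ∀ v, Tendsto (fun t : ℝ => t⁻¹ • (P.phi (z + (t : ℂ) * v) - P.phi z)) (𝓝[>] 0)
      (𝓝 (P.tangentPhi A z v)) := by
  have hzF := interior_subset hz
  have him := P.im_pos hzF
  have hz' := P.mem_interior_iff.1 hz
  obtain ⟨a, ha⟩ := P.exists_hasDerivWithinAt_Ici (Ioo_subset_Ico_self hz'.1)
  obtain ⟨b, hb⟩ := P.exists_hasDerivWithinAt_Iic (Ioo_subset_Ioc_self hz'.1)
  refine ⟨kinkDeriv a b, fun v => ?_⟩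
  have hr := hasDerivWithinAt_comp_line (hasFDerivAt_norm_of_im_pos him) v
  have harg := hasDerivWithinAt_comp_line (hasFDerivAt_arg him) v
  have h0 : ‖z + ((0 : ℝ) : ℂ) * v‖ = ‖z‖ := by simp
  have h0' : (z + ((0 : ℝ) : ℂ) * v).arg = z.arg := by simp
  have hα := hasDerivWithinAt_comp_of_kink (f := P.α) (r := fun t : ℝ => ‖z + (t : ℂ) * v‖)
    (a := a) (b := b) (by rwa [h0]) (by rwa [h0]) hr
  have hang : HasFDerivAt (fun p : ℝ × ℝ => Real.pi / (Real.pi - 2 * p.1) * (p.2 - p.1))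
      (P.stretch ‖z‖ • (ContinuousLinearMap.snd ℝ ℝ ℝ - ContinuousLinearMap.fst ℝ ℝ ℝ) +
        P.shear z • ContinuousLinearMap.fst ℝ ℝ ℝ)
      (P.α ‖z + ((0 : ℝ) : ℂ) * v‖, (z + ((0 : ℝ) : ℂ) * v).arg) := by
    rw [h0, h0']; exact P.hasFDerivAt_angle hzF
  have h1 := hang.comp_hasDerivWithinAt (0 : ℝ)
    (f := fun t : ℝ => (P.α ‖z + (t : ℂ) * v‖, (z + (t : ℂ) * v).arg)) (hα.prodMk harg)
  have h2 := (hasDerivWithinAt_iff_tendsto_slope' self_notMem_Ioi).1 (h1.prodMk hr)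
  refine h2.congr fun t => ?_
  rw [slope_def_module, sub_zero, h0, ← show P.phi z = _ from rfl]
  simp [phi]

/-! ### The one-sided situation on the sides -/

/-- No kink is visible from a side: on the extreme arcs only one slope of `α` enters, and open flank
arcs avoid the radii `ρ k`. -/
theorem exists_hasDerivWithinAt_Icc (hn : 0 < n) {s : PolySide n} {z : ℂ} (hz : z ∈ P.side s) :
    ∃ a, HasDerivWithinAt P.α a (Icc (P.ρ 0) (P.ρ (Fin.last n))) ‖z‖ := by
  have h0n : P.ρ 0 < P.ρ (Fin.last n) := P.ρ_strictMono (Fin.lt_def.2 (by simpa using hn))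
  cases s with
  | bottom =>
    obtain ⟨a, ha⟩ := P.exists_hasDerivWithinAt_Ici (left_mem_Ico.2 h0n)
    refine ⟨a, ?_⟩
    rw [hz.1]
    exact ha.mono Icc_subset_Ici_self
  | top =>
    obtain ⟨a, ha⟩ := P.exists_hasDerivWithinAt_Iic (right_mem_Ioc.2 h0n)
    refine ⟨a, ?_⟩
    rw [hz.1]
    exact ha.mono Icc_subset_Iic_self
  | right k =>
    exact ⟨_, ((P.contDiffAt_α hz.1).differentiableAt (by simp)).hasDerivAt.hasDerivWithinAt⟩
  | left k =>
    exact ⟨_, ((P.contDiffAt_α hz.1).differentiableAt (by simp)).hasDerivAt.hasDerivWithinAt⟩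

/-- The side is the zero level of a function positive inside the region. Directions in which its
derivative is positive form an open half plane and point into the region. -/
theorem uniqueDiffWithinAt_side (hn : 0 < n) {s : PolySide n} {z : ℂ} (hz : z ∈ P.side s) :
    UniqueDiffWithinAt ℝ P.domain z := by
  have h0n : P.ρ 0 < P.ρ (Fin.last n) := P.ρ_strictMono (Fin.lt_def.2 (by simpa using hn))
  have hzF := P.side_subset s hz
  have him := P.im_pos hzF
  have hr := P.norm_pos_of_mem hzF
  have hz0 : z ≠ 0 := norm_pos_iff.1 hr
  have hαz := P.α_lt _ hzF.1
  have hnorm : ∀ v, HasDerivWithinAt (fun t : ℝ => ‖z + (t : ℂ) * v‖) (normDeriv z v) (Ioi 0) 0 :=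
    fun v => hasDerivWithinAt_comp_line (hasFDerivAt_norm_of_im_pos him) v
  have harg : ∀ v, HasDerivWithinAt (fun t : ℝ => (z + (t : ℂ) * v).arg) (argDeriv z v) (Ioi 0) 0 :=
    fun v => hasDerivWithinAt_comp_line (hasFDerivAt_arg him) v
  have hflank : ∀ k : Fin n, ‖z‖ ∈ Ioo (P.ρ k.castSucc) (P.ρ k.succ) → ∃ L : ℂ →L[ℝ] ℝ,
      L (z * Complex.I) = 1 ∧ ∀ v,
        HasDerivWithinAt (fun t : ℝ => (z + (t : ℂ) * v).arg - P.α ‖z + (t : ℂ) * v‖) (L v)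
          (Ioi 0) 0 := by
    intro k hk
    have h1 := ((P.contDiffAt_α hk).differentiableAt (by simp)).hasDerivAt.comp_hasFDerivAt z
      (hasFDerivAt_norm_of_im_pos him)
    refine ⟨_, ?_, fun v => hasDerivWithinAt_comp_line ((hasFDerivAt_arg him).sub h1) v⟩
    simp [normDeriv_mul_I hz0, argDeriv_mul_I hz0]
  have hIcc : ∀ k : Fin n, ‖z‖ ∈ Ioo (P.ρ k.castSucc) (P.ρ k.succ) →
      ∀ᶠ y : ℂ in 𝓝 z, ‖y‖ ∈ Icc (P.ρ 0) (P.ρ (Fin.last n)) := fun k hk =>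
    (continuous_norm.continuousAt.eventually (isOpen_Ioo.mem_nhds hk)).mono fun y hy =>
      P.Icc_subset k (Ioo_subset_Icc_self hy)
  cases s with
  | bottom =>
    refine uniqueDiffWithinAt_of_eventually_mem (U := {v | 0 < normDeriv z v}) hzF
      (isOpen_lt continuous_const (normDeriv z).continuous)
      ⟨z, by simpa [normDeriv_self hz0] using hz0⟩ fun v hv => ?_
    have h1 := (hnorm v).eventually_gt hv
    have h2 := tendsto_add_mul z v
    have h3 : ‖z‖ < P.ρ (Fin.last n) := hz.1 ▸ h0n
    filter_upwards [h1, h2.eventually (P.eventually_lt_arg hzF hz.2.1),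
      h2.eventually (P.eventually_arg_lt hzF hz.2.2),
      h2.norm.eventually_lt_const h3] with t i1 i2 i3 i4
    simp only [Complex.ofReal_zero, zero_mul, add_zero, hz.1] at i1
    exact ⟨⟨i1.le, i4.le⟩, (i2 ⟨i1.le, i4.le⟩).le, (i3 ⟨i1.le, i4.le⟩).le⟩
  | top =>
    refine uniqueDiffWithinAt_of_eventually_mem (U := {v | 0 < -normDeriv z v}) hzF
      (isOpen_lt continuous_const (normDeriv z).continuous.neg)
      ⟨-z, by simpa [normDeriv_self hz0] using hz0⟩ fun v hv => ?_
    have h1 := (hnorm v).neg.eventually_gt hv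
    have h2 := tendsto_add_mul z v
    have h3 : P.ρ 0 < ‖z‖ := hz.1 ▸ h0n
    filter_upwards [h1, h2.eventually (P.eventually_lt_arg hzF hz.2.1),
      h2.eventually (P.eventually_arg_lt hzF hz.2.2),
      h2.norm.eventually_const_lt h3] with t i1 i2 i3 i4
    simp only [Pi.neg_apply, Complex.ofReal_zero, zero_mul, add_zero, hz.1, neg_lt_neg_iff] at i1
    exact ⟨⟨i4.le, i1.le⟩, (i2 ⟨i4.le, i1.le⟩).le, (i3 ⟨i4.le, i1.le⟩).le⟩
  | right k =>
    obtain ⟨L, hL, hderiv⟩ := hflank k hz.1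
    refine uniqueDiffWithinAt_of_eventually_mem (U := {v | 0 < L v}) hzF
      (isOpen_lt continuous_const L.continuous) ⟨z * Complex.I, by simp [hL]⟩ fun v hv => ?_
    have h1 := (hderiv v).eventually_gt hv
    have h2 := tendsto_add_mul z v
    have h3 : z.arg < Real.pi - P.α ‖z‖ := by rw [hz.2]; linarith
    filter_upwards [h1, h2.eventually (P.eventually_arg_lt hzF h3),
      h2.eventually (hIcc k hz.1)] with t i1 i2 i3
    simp only [Complex.ofReal_zero, zero_mul, add_zero, hz.2, sub_self] at i1
    exact ⟨i3, by linarith, (i2 i3).le⟩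
  | left k =>
    obtain ⟨L, hL, hderiv⟩ := hflank k hz.1
    -- On the left flank the inward function is `π - α ‖z‖ - arg z`; the constant `π` is dropped.
    have hcont : ∀ v, HasDerivWithinAt
        (fun t : ℝ => -((z + (t : ℂ) * v).arg + P.α ‖z + (t : ℂ) * v‖))
        (-(argDeriv z v + deriv P.α ‖z‖ * normDeriv z v)) (Ioi 0) 0 := fun v =>
      ((harg v).add (hasDerivWithinAt_comp_line
        (((P.contDiffAt_α hz.1).differentiableAt (by simp)).hasDerivAt.comp_hasFDerivAt z
          (hasFDerivAt_norm_of_im_pos him)) v)).neg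
    refine uniqueDiffWithinAt_of_eventually_mem
      (U := {v | 0 < -(argDeriv z v + deriv P.α ‖z‖ * normDeriv z v)}) hzF
      (isOpen_lt continuous_const ((argDeriv z).continuous.add
        (continuous_const.mul (normDeriv z).continuous)).neg)
      ⟨-(z * Complex.I), by simp [normDeriv_mul_I hz0, argDeriv_mul_I hz0]⟩ fun v hv => ?_
    have h1 := (hcont v).eventually_gt hv
    have h2 := tendsto_add_mul z v
    have h3 : P.α ‖z‖ < z.arg := by rw [hz.2]; linarith
    filter_upwards [h1, h2.eventually (P.eventually_lt_arg hzF h3),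
      h2.eventually (hIcc k hz.1)] with t i1 i2 i3
    simp only [Complex.ofReal_zero, zero_mul, add_zero, hz.2] at i1
    exact ⟨i3, (i2 i3).le, by linarith⟩

/-! ### Lifts of vectors -/

theorem pushesTo_iff_of_mem_interior {z : ℂ} (hz : z ∈ interior P.domain) (v : ℂ) (u : ℝ × ℝ) :
    P.PushesTo z v u ↔
      Tendsto (fun t : ℝ => t⁻¹ • (P.phi (z + (t : ℂ) * v) - P.phi z)) (𝓝[>] 0) (𝓝 u) := by
  refine ⟨?_, fun h => Or.inl ⟨hz, h⟩⟩
  rintro (h | ⟨⟨s, hs⟩, -⟩ | ⟨hc, -⟩)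
  · exact h.2
  · exact (P.notMem_interior_of_mem_side hs hz).elim
  · exact (P.notMem_interior_of_mem_cusps hc hz).elim

theorem pushesTo_iff_of_mem_cusps {z : ℂ} (hz : z ∈ P.cusps) (v : ℂ) (u : ℝ × ℝ) :
    P.PushesTo z v u ↔ v = 0 ∧ u = 0 := by
  refine ⟨?_, fun h => Or.inr (Or.inr ⟨hz, h⟩)⟩
  rintro (h | ⟨⟨s, hs⟩, -⟩ | h)
  · exact (P.notMem_interior_of_mem_cusps hz h.1).elim
  · exact (P.notMem_cusps_of_mem_side hs hz).elim
  · exact h.2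

theorem pushesTo_iff_of_mem_side {s : PolySide n} {z : ℂ} (hz : z ∈ P.side s) (v : ℂ)
    (u : ℝ × ℝ) : P.PushesTo z v u ↔
      ∃ L : ℂ →L[ℝ] ℝ × ℝ, HasFDerivWithinAt P.phi L P.domain z ∧ L v = u := by
  refine ⟨?_, fun h => Or.inr (Or.inl ⟨⟨s, hz⟩, h⟩)⟩
  rintro (h | h | h)
  · exact (P.notMem_interior_of_mem_side hz h.1).elim
  · exact h.2
  · exact (P.notMem_cusps_of_mem_side hz h.1).elim

/-- Every vector (the zero vector at a corner) has a unique lift under the tangent map of `φ`. -/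
theorem existsUnique_pushesTo (hn : 0 < n) {z : ℂ} (hz : z ∈ P.domain) {u : ℝ × ℝ}
    (hu : z ∈ P.cusps → u = 0) : ∃! v, P.PushesTo z v u := by
  rcases P.mem_domain_cases hz with hi | ⟨s, hs⟩ | hc
  · obtain ⟨A, hA⟩ := P.tendsto_phi_slope hi
    have key (v : ℂ) : P.PushesTo z v u ↔ v = P.tangentPhiInv A z u := by
      rw [P.pushesTo_iff_of_mem_interior hi, ← P.tangentPhi_eq_iff A hz]
      exact ⟨fun h => tendsto_nhds_unique (hA v) h, fun h => h ▸ hA v⟩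
    simp only [key, existsUnique_eq]
  · obtain ⟨a, ha⟩ := P.exists_hasDerivWithinAt_Icc hn hs
    obtain ⟨L, hL, hLv⟩ := P.hasFDerivWithinAt_phi hz
      (ha.comp_hasFDerivWithinAt z
        (hasFDerivAt_norm_of_im_pos (P.im_pos hz)).hasFDerivWithinAt
        fun (y : ℂ) (hy : y ∈ P.domain) => hy.1)
    have key (v : ℂ) : P.PushesTo z v u ↔ v = P.tangentPhiInv (fun x => a * x) z u := by
      rw [P.pushesTo_iff_of_mem_side hs, ← P.tangentPhi_eq_iff _ hz, ← hLv]
      refine ⟨?_, fun h => ⟨L, hL, h⟩⟩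
      rintro ⟨L', hL', h⟩
      -- Any derivative within the region that witnesses `PushesTo` is the computed one.
      rwa [(P.uniqueDiffWithinAt_side hn hs).eq hL hL']
    simp only [key, existsUnique_eq]
  · simp only [P.pushesTo_iff_of_mem_cusps hc, hu hc, and_true, existsUnique_eq]

/-- Off the arcs through the corners the lift is given by the derivative of `α`. -/
theorem pushesTo_tangentPhiInv {k : Fin n} {z : ℂ} (hz : z ∈ interior P.domain)
    (hk : ‖z‖ ∈ Ioo (P.ρ k.castSucc) (P.ρ k.succ)) (u : ℝ × ℝ) :
    P.PushesTo z (P.tangentPhiInv (fun x => deriv P.α ‖z‖ * x) z u) u := by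
  have hzF := interior_subset hz
  rw [P.pushesTo_iff_of_mem_interior hz]
  obtain ⟨L, hL, hLv⟩ := P.hasFDerivWithinAt_phi (s := univ) hzF
    (((P.contDiffAt_α hk).differentiableAt (by simp)).hasDerivAt.comp_hasFDerivAt z
        (hasFDerivAt_norm_of_im_pos (P.im_pos hzF))).hasFDerivWithinAt
  have h := hasDerivWithinAt_comp_line (hasFDerivWithinAt_univ.1 hL)
    (P.tangentPhiInv (fun x => deriv P.α ‖z‖ * x) z u)
  rw [hLv, (P.tangentPhi_eq_iff _ hzF _ _).2 rfl,
    hasDerivWithinAt_iff_tendsto_slope' self_notMem_Ioi] at h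
  refine h.congr fun t => ?_
  rw [slope_def_module]
  simp

theorem contDiffAt_phi {k : Fin n} {z : ℂ} (hz : z ∈ P.domain)
    (hk : ‖z‖ ∈ Ioo (P.ρ k.castSucc) (P.ρ k.succ)) : ContDiffAt ℝ ∞ P.phi z := by
  have h0 := norm_pos_iff.1 (P.norm_pos_of_mem hz)
  have hn : ContDiffAt ℝ ∞ (fun y : ℂ => ‖y‖) z := contDiffAt_norm ℝ h0
  have hα : ContDiffAt ℝ ∞ (fun y : ℂ => P.α ‖y‖) z := (P.contDiffAt_α hk).comp z hn
  exact ((contDiffAt_const.div (contDiffAt_const.sub (contDiffAt_const.mul hα))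
    (P.pi_sub_pos hz).ne').mul ((contDiffAt_arg (P.im_pos hz)).sub hα)).prodMk hn

theorem contDiffAt_tangentPhiInv {k : Fin n} {z : ℂ} (hz : z ∈ P.domain)
    (hk : ‖z‖ ∈ Ioo (P.ρ k.castSucc) (P.ρ k.succ)) {u : ℂ → ℝ × ℝ} (hu : ContDiffAt ℝ ∞ u z) :
    ContDiffAt ℝ ∞ (fun y => P.tangentPhiInv (fun x => deriv P.α ‖y‖ * x) y (u y)) z := by
  have h0 := P.norm_pos_of_mem hz
  have hn : ContDiffAt ℝ ∞ (fun y : ℂ => ‖y‖) z := contDiffAt_norm ℝ (norm_pos_iff.1 h0)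
  have hα : ContDiffAt ℝ ∞ (fun y : ℂ => P.α ‖y‖) z := (P.contDiffAt_α hk).comp z hn
  have hα' : ContDiffAt ℝ ∞ (fun y : ℂ => deriv P.α ‖y‖) z :=
    ContDiffAt.comp (g := deriv P.α) z (((P.contDiffAt_α hk).fderiv_right (m := ∞) (by simp)).clm_apply
      contDiffAt_const) hn
  have hD := (P.pi_sub_pos hz).ne'
  have hs : ContDiffAt ℝ ∞ (fun y : ℂ => P.stretch ‖y‖) z :=
    contDiffAt_const.div (contDiffAt_const.sub (contDiffAt_const.mul hα)) hD
  have hsh : ContDiffAt ℝ ∞ P.shear z :=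
    (contDiffAt_const.div ((contDiffAt_const.sub (contDiffAt_const.mul hα)).pow 2)
      (pow_ne_zero 2 hD)).mul ((contDiffAt_arg (P.im_pos hz)).sub hα)
  have hA := hα'.mul hu.snd
  have h1 : ContDiffAt ℝ ∞ (fun y : ℂ => (u y).2 / ‖y‖) z := hu.snd.div hn h0.ne'
  have h2 : ContDiffAt ℝ ∞ (fun y : ℂ =>
      ((u y).1 - P.shear y * (deriv P.α ‖y‖ * (u y).2)) / P.stretch ‖y‖ +
        deriv P.α ‖y‖ * (u y).2) z :=
    ((hu.fst.sub (hsh.mul hA)).div hs (P.stretch_pos hz).ne').add hA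
  have hof : ContDiff ℝ ∞ (fun x : ℝ => (x : ℂ)) := Complex.ofRealCLM.contDiff
  exact contDiffAt_id.mul ((hof.contDiffAt.comp z h1).add
    ((hof.contDiffAt.comp z h2).mul contDiffAt_const))

end PolarPolygon

namespace PolarPolygon

variable {n : ℕ} {P : PolarPolygon n} {Γ : Subgroup SL(2, ℝ)}

/-! ### Equivalent points of the region -/

theorem exists_mem_interior_of_mem_nhds (hn : 0 < n) {z : UpperHalfPlane}
    (hz : (z : ℂ) ∈ P.domain) {O : Set UpperHalfPlane} (hO : O ∈ 𝓝 z) :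
    ∃ y ∈ O, (y : ℂ) ∈ interior P.domain := by
  have h := UpperHalfPlane.isOpenEmbedding_coe.image_mem_nhds.2 hO
  obtain ⟨_, ⟨y, hy, rfl⟩, hy'⟩ :=
    mem_closure_iff_nhds.1 (P.domain_subset_closure_interior hn hz) _ h
  exact ⟨y, hy, hy'⟩

/-- A transform of a neighbourhood of `z` contains interior points of the region if `γ • z` lies in
the region. -/
theorem exists_smul_mem_interior (hn : 0 < n) (γ : SL(2, ℝ)) {z : UpperHalfPlane}
    (hz : ((γ • z : UpperHalfPlane) : ℂ) ∈ P.domain) {O : Set UpperHalfPlane} (hO : O ∈ 𝓝 z) :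
    ∃ y ∈ O, ((γ • y : UpperHalfPlane) : ℂ) ∈ interior P.domain := by
  have h : (fun x : UpperHalfPlane => γ⁻¹ • x) ⁻¹' O ∈ 𝓝 (γ • z) :=
    (continuous_const_smul γ⁻¹).continuousAt.preimage_mem_nhds (by simpa using hO)
  obtain ⟨x, hx, hx'⟩ := exists_mem_interior_of_mem_nhds hn hz h
  exact ⟨γ⁻¹ • x, hx, by simpa using hx'⟩

theorem isOpen_smul_ne (γ δ : SL(2, ℝ)) : IsOpen {y : UpperHalfPlane | γ • y ≠ δ • y} :=
  isOpen_ne_fun (continuous_const_smul γ) (continuous_const_smul δ)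

/-- The definition compares interior points only. If `γ` moved `z`, it would move all nearby points,
and some of these are interior with interior image, since `γ • z` is a limit of interior points. -/
theorem smul_eq_of_mem_interior (hn : 0 < n) (hF : P.IsFundamentalDomainOf Γ) {γ : SL(2, ℝ)}
    (hγ : γ ∈ Γ) {z : UpperHalfPlane} (hz : (z : ℂ) ∈ interior P.domain)
    (hz' : ((γ • z : UpperHalfPlane) : ℂ) ∈ P.domain) : γ • z = z := by
  by_contra hne
  have h1 : {y : UpperHalfPlane | γ • y ≠ (1 : SL(2, ℝ)) • y} ∈ 𝓝 z :=
    (isOpen_smul_ne γ 1).mem_nhds (by simpa using hne)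
  have h2 : {y : UpperHalfPlane | (y : ℂ) ∈ interior P.domain} ∈ 𝓝 z :=
    (isOpen_interior.preimage UpperHalfPlane.continuous_coe).mem_nhds hz
  obtain ⟨y, ⟨hy1, hy2⟩, hy⟩ := exists_smul_mem_interior hn γ hz' (inter_mem h1 h2)
  exact hy1 (by simpa using hF.2 γ hγ y hy2 hy)

/-- Near a point of a side the region and its neighbour across the side cover the plane. -/
theorem eventually_mem_domain_or (hn : 0 < n) (hF : P.IsFundamentalDomainOf Γ)
    (A : P.SidePairing Γ) {s : PolySide n} {q : UpperHalfPlane} (hq : (q : ℂ) ∈ P.side s) :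
    ∀ᶠ y : UpperHalfPlane in 𝓝 q,
      (y : ℂ) ∈ P.domain ∨ ((A.T s • y : UpperHalfPlane) : ℂ) ∈ P.domain := by
  set T := A.T s with hT
  have hqD := P.side_subset s hq
  have hTq : ((T • q : UpperHalfPlane) : ℂ) ∈ P.side (A.σ s) := (A.T_maps s q).1 hq
  have hTqD := P.side_subset _ hTq
  have hcontT : Continuous fun y : UpperHalfPlane => T • y := continuous_const_smul T
  obtain ⟨B', -, hB'o, hqB', hB'sub, -, -⟩ := P.exists_collar hn hTq univ_mem
  have hN : (UpperHalfPlane.coe '' {y : UpperHalfPlane | ((T • y : UpperHalfPlane) : ℂ) ∈ B'}) ∈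
      𝓝 (q : ℂ) :=
    UpperHalfPlane.isOpenEmbedding_coe.image_mem_nhds.2
      ((hB'o.preimage (UpperHalfPlane.continuous_coe.comp hcontT)).mem_nhds hqB')
  obtain ⟨B, hBN, hBo, hqB, hBsub, hpre1, hpre2⟩ := P.exists_collar hn hq hN
  have hlift : ∀ x ∈ B, ∃ y : UpperHalfPlane, (y : ℂ) = x := fun x hx => by
    obtain ⟨y, -, rfl⟩ := hBN hx
    exact ⟨y, rfl⟩
  have hTB : ∀ y : UpperHalfPlane, (y : ℂ) ∈ B → ((T • y : UpperHalfPlane) : ℂ) ∈ B' := by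
    intro y hy
    obtain ⟨y', hy', h⟩ := hBN hy
    rwa [UpperHalfPlane.ext h] at hy'
  have hpre : ∀ C ⊆ B, IsPreconnected C →
      IsPreconnected {y : UpperHalfPlane | (y : ℂ) ∈ C} := by
    intro C hC hCpre
    rw [← UpperHalfPlane.isOpenEmbedding_coe.isInducing.isPreconnected_image]
    convert hCpre
    ext x
    constructor
    · rintro ⟨y, hy, rfl⟩
      exact hy
    · intro hx
      obtain ⟨y, rfl⟩ := hlift x (hC hx)
      exact ⟨y, hx, rfl⟩
  have hBq : {y : UpperHalfPlane | (y : ℂ) ∈ B} ∈ 𝓝 q :=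
    (hBo.preimage UpperHalfPlane.continuous_coe).mem_nhds hqB
  set U₁ : Set UpperHalfPlane := {y | ((T • y : UpperHalfPlane) : ℂ) ∈ interior P.domain}
  set U₂ : Set UpperHalfPlane := {y | ((T • y : UpperHalfPlane) : ℂ) ∈ P.domainᶜ}
  have hU₁ : IsOpen U₁ := isOpen_interior.preimage (UpperHalfPlane.continuous_coe.comp hcontT)
  have hU₂ : IsOpen U₂ := P.isCompact_domain.isClosed.isOpen_compl.preimage
    (UpperHalfPlane.continuous_coe.comp hcontT)
  have hdisj : Disjoint U₁ U₂ :=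
    Set.disjoint_left.2 fun y h1 h2 => h2 (interior_subset h1)
  have hcover : ∀ y : UpperHalfPlane, (y : ℂ) ∈ B → (y : ℂ) ∉ P.side s → y ∈ U₁ ∪ U₂ := by
    intro y hy hys
    rcases hB'sub (hTB y hy) with (h | h) | h
    · exact Or.inl h
    · exact (hys ((A.T_maps s y).2 h)).elim
    · exact Or.inr h
  -- Only points of side `s` are sent to side `σ s`, so each connected half of the collar goes
  -- entirely inside or entirely outside the region.
  have hin := (hpre _ inter_subset_left hpre1).subset_or_subset hU₁ hU₂ hdisj
    fun y hy => hcover y hy.1 fun h => P.notMem_interior_of_mem_side h hy.2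
  have hout := (hpre _ sdiff_subset hpre2).subset_or_subset hU₁ hU₂ hdisj
    fun y hy => hcover y hy.1 fun h => hy.2 (P.side_subset s h)
  have hin₂ : {y : UpperHalfPlane | (y : ℂ) ∈ B ∩ interior P.domain} ⊆ U₂ := by
    -- Otherwise `T` would fix interior points arbitrarily near `q`, but `T • q ≠ q` because they
    -- lie on different sides.
    refine hin.resolve_left fun hin₁ => ?_
    have hne : T • q ≠ q := fun h => A.σ_ne s (P.side_unique hn (h ▸ hTq) hq)
    have h1 : {y : UpperHalfPlane | T • y ≠ (1 : SL(2, ℝ)) • y} ∈ 𝓝 q :=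
      (isOpen_smul_ne T 1).mem_nhds (by simpa using hne)
    obtain ⟨y, ⟨hy1, hy2⟩, hy⟩ := exists_mem_interior_of_mem_nhds hn hqD (inter_mem h1 hBq)
    exact hy1 (by simpa using hF.2 T (A.T_mem s) y hy (hin₁ ⟨hy2, hy⟩))
  have hout₁ : {y : UpperHalfPlane | (y : ℂ) ∈ B \ P.domain} ⊆ U₁ := by
    -- Otherwise no point near `q` would be sent to the interior, although `T • q` is a limit of
    -- interior points.
    refine hout.resolve_right fun hout₂ => ?_
    obtain ⟨y, hy, hyT⟩ := exists_smul_mem_interior hn T hTqD hBq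
    rcases hBsub hy with (h | h) | h
    · exact hin₂ ⟨hy, h⟩ (interior_subset hyT)
    · exact P.notMem_interior_of_mem_side ((A.T_maps s y).1 h) hyT
    · exact hout₂ ⟨hy, h⟩ (interior_subset hyT)
  filter_upwards [hBq] with y hy
  by_cases h : (y : ℂ) ∈ P.domain
  · exact Or.inl h
  · exact Or.inr (interior_subset (hout₁ ⟨hy, h⟩))

/-- If both equalities failed at `q` they would fail nearby. Take `y` near `q` with `γ • y`
interior: `y` or `T s • y` lies in the region, so it equals `γ • y` by `smul_eq_of_mem_interior`. -/
theorem smul_eq_or_of_mem_side (hn : 0 < n) (hF : P.IsFundamentalDomainOf Γ)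
    (A : P.SidePairing Γ) {s : PolySide n} {q : UpperHalfPlane} (hq : (q : ℂ) ∈ P.side s)
    {γ : SL(2, ℝ)} (hγ : γ ∈ Γ) (hq' : ((γ • q : UpperHalfPlane) : ℂ) ∈ P.domain) :
    γ • q = q ∨ γ • q = A.T s • q := by
  by_contra! hne
  have h1 : {y : UpperHalfPlane | γ • y ≠ (1 : SL(2, ℝ)) • y} ∈ 𝓝 q :=
    (isOpen_smul_ne γ 1).mem_nhds (by simpa using hne.1)
  have h2 : {y : UpperHalfPlane | γ • y ≠ A.T s • y} ∈ 𝓝 q := (isOpen_smul_ne γ _).mem_nhds hne.2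
  obtain ⟨y, ⟨⟨hy1, hy2⟩, hy3⟩, hy⟩ := exists_smul_mem_interior hn γ hq'
    (inter_mem (inter_mem h1 h2) (eventually_mem_domain_or hn hF A hq))
  rcases hy3 with h | h
  · have := smul_eq_of_mem_interior hn hF (Γ.inv_mem hγ) hy (by simpa using h)
    exact hy1 (by simpa using this.symm)
  · have := smul_eq_of_mem_interior hn hF (Γ.mul_mem (A.T_mem s) (Γ.inv_mem hγ)) hy
      (by simpa [mul_smul] using h)
    exact hy2 (by simpa [mul_smul] using this.symm)

/-- Apply the two preceding results to `γ⁻¹` at `γ • q`: from an interior or side point one only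
reaches that point itself or its partner on the paired side. -/
theorem smul_mem_cusps (hn : 0 < n) (hF : P.IsFundamentalDomainOf Γ)
    (A : P.SidePairing Γ) {q : UpperHalfPlane} (hq : (q : ℂ) ∈ P.cusps)
    {γ : SL(2, ℝ)} (hγ : γ ∈ Γ) (hq' : ((γ • q : UpperHalfPlane) : ℂ) ∈ P.domain) :
    ((γ • q : UpperHalfPlane) : ℂ) ∈ P.cusps := by
  have hqD := P.cusps_subset hq
  rcases P.mem_domain_cases hq' with h | ⟨s, h⟩ | h
  · have := smul_eq_of_mem_interior hn hF (Γ.inv_mem hγ) h (by simpa using hqD)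
    rw [inv_smul_smul] at this
    rw [← this] at h
    exact (P.notMem_interior_of_mem_cusps hq h).elim
  · rcases smul_eq_or_of_mem_side hn hF A h (Γ.inv_mem hγ) (by simpa using hqD) with h' | h'
    · rw [inv_smul_smul] at h'
      rwa [← h']
    · rw [inv_smul_smul] at h'
      have := (A.T_maps s _).1 h
      rw [← h'] at this
      exact (P.notMem_cusps_of_mem_side this hq).elim
  · exact h

end PolarPolygon

/-! ### The upper half plane as a real manifold -/

theorem mdifferentiableAt_moebius (g : SL(2, ℝ)) (z : UpperHalfPlane) :
    MDifferentiableAt 𝓘(ℝ, ℂ) 𝓘(ℝ, ℂ) (fun y : UpperHalfPlane => g • y) z := by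
  have h : MDifferentiableAt 𝓘(ℂ) 𝓘(ℂ) (fun y : UpperHalfPlane => g • y) z :=
    UpperHalfPlane.mdifferentiable_smul (g := (g : GL (Fin 2) ℝ)) (by simp) z
  rw [mdifferentiableAt_iff] at h ⊢
  exact ⟨h.1, h.2.restrictScalars ℝ⟩

instance UpperHalfPlane.isManifold_real : IsManifold 𝓘(ℝ, ℂ) ∞ UpperHalfPlane :=
  UpperHalfPlane.isOpenEmbedding_coe.isManifold_singleton

theorem UpperHalfPlane.contMDiff_coe_real :
    ContMDiff 𝓘(ℝ, ℂ) 𝓘(ℝ, ℂ) ∞ (UpperHalfPlane.coe) :=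
  fun _ => contMDiffAt_extChartAt

/-- The vector field on the upper half plane given by a function. -/
def UpperHalfPlane.vectorField (f : ℂ → ℂ) (z : UpperHalfPlane) : TangentSpace 𝓘(ℝ, ℂ) z := f z

/-- A vector field on the upper half plane is smooth if it is smooth as a function. -/
theorem UpperHalfPlane.contMDiffAt_vectorField {f : ℂ → ℂ} {z : UpperHalfPlane}
    (hf : ContDiffAt ℝ ∞ f z) :
    ContMDiffAt 𝓘(ℝ, ℂ) 𝓘(ℝ, ℂ).tangent ∞
      (fun y => (⟨y, vectorField f y⟩ : TangentBundle 𝓘(ℝ, ℂ) UpperHalfPlane)) z := by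
  refine (Bundle.contMDiffAt_section z).2 ?_
  have h : ContMDiffAt 𝓘(ℝ, ℂ) 𝓘(ℝ, ℂ) ∞ (fun y : UpperHalfPlane => f y) z :=
    hf.contMDiffAt.comp z (UpperHalfPlane.contMDiff_coe_real z)
  refine h.congr_of_eventuallyEq (Eventually.of_forall fun y => ?_)
  -- The upper half plane has a single chart, so the coordinate change is the identity.
  exact tangentCoordChange_self (I := 𝓘(ℝ, ℂ)) (x := y) (z := y) (v := f y)
    (mem_extChartAt_source y)

/-! ### Vector fields and the quotient map -/

namespace IsQuotientSurface

variable {Γ : Subgroup SL(2, ℝ)} {S : Type*} [TopologicalSpace S] [ChartedSpace Plane S]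
  {π : UpperHalfPlane → S}

/-- Differentiate `π ∘ γ = π`. -/
theorem mfderiv_smul (hπ : IsQuotientSurface Γ π) {γ : SL(2, ℝ)} (hγ : γ ∈ Γ)
    (z : UpperHalfPlane) (v : ℂ) :
    (mfderiv 𝓘(ℝ, ℂ) 𝓘(ℝ, Plane) π (γ • z) (PolarPolygon.moebiusTangent γ z v) : Plane) =
      mfderiv 𝓘(ℝ, ℂ) 𝓘(ℝ, Plane) π z v := by
  have h1 : MDifferentiableAt 𝓘(ℝ, ℂ) 𝓘(ℝ, Plane) π (γ • z) :=
    (hπ.localDiffeo (γ • z)).mdifferentiableAt (by simp)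
  have h2 := mfderiv_comp_apply z h1 (mdifferentiableAt_moebius γ z) v
  have h3 : π ∘ (fun y : UpperHalfPlane => γ • y) = π :=
    funext fun y => ((hπ.fibres y (γ • y)).2 ⟨γ, hγ, rfl⟩).symm
  rw [h3] at h2
  exact h2.symm

/-- If the lift of a vector field to the upper half plane agrees near a point with a smooth
function, then the vector field is smooth at the image of this point. -/
theorem contMDiffAt_of_lift [IsManifold 𝓘(ℝ, Plane) ∞ S] (hπ : IsQuotientSurface Γ π)
    {V : (x : S) → TangentSpace 𝓘(ℝ, Plane) x} {f : ℂ → ℂ} {z : UpperHalfPlane}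
    (hf : ContDiffAt ℝ ∞ f z)
    (hV : ∀ᶠ y : UpperHalfPlane in 𝓝 z,
      (mfderiv 𝓘(ℝ, ℂ) 𝓘(ℝ, Plane) π y (f y) : Plane) = V (π y)) :
    ContMDiffAt 𝓘(ℝ, Plane) 𝓘(ℝ, Plane).tangent ∞
      (fun x => (⟨x, V x⟩ : TangentBundle 𝓘(ℝ, Plane) S)) (π z) := by
  have hloc := hπ.localDiffeo z
  set σ := hloc.localInverse with hσ
  have hσz : σ (π z) = z := hloc.localInverse_left_inv hloc.localInverse_mem_target
  have hσsmooth : ContMDiffAt 𝓘(ℝ, Plane) 𝓘(ℝ, ℂ) ∞ σ (π z) := hloc.localInverse_contMDiffAt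
  have hsrc : σ.source ∈ 𝓝 (π z) := σ.open_source.mem_nhds hloc.localInverse_mem_source
  have hlocσ : ∀ x ∈ σ.source, IsLocalDiffeomorphAt 𝓘(ℝ, Plane) 𝓘(ℝ, ℂ) ∞ σ x :=
    fun x hx => σ.isLocalDiffeomorphAt _ _ _ hx
  have : IsManifold 𝓘(ℝ, Plane) 1 S := IsManifold.of_le (n := ∞) (by simp)
  have : IsManifold 𝓘(ℝ, ℂ) 1 UpperHalfPlane := IsManifold.of_le (n := ∞) (by simp)
  -- Near `π z` the field `V` is the pullback of `f` under the local inverse `σ` of `π`, and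
  -- pullbacks under local diffeomorphisms are smooth.
  have hpull := ContMDiffAt.mpullback_vectorField_preimage (I := 𝓘(ℝ, Plane)) (I' := 𝓘(ℝ, ℂ))
    (f := σ) (V := UpperHalfPlane.vectorField f) (m := ∞) (n := ∞) (x₀ := π z)
    (by rw [hσz]; exact UpperHalfPlane.contMDiffAt_vectorField hf) hσsmooth
    ⟨(hlocσ _ (mem_of_mem_nhds hsrc)).mfderivToContinuousLinearEquiv (by simp), rfl⟩ (by simp)
  refine hpull.congr_of_eventuallyEq ?_
  have hV' : ∀ᶠ x in 𝓝 (π z),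
      (mfderiv 𝓘(ℝ, ℂ) 𝓘(ℝ, Plane) π (σ x) (f (σ x)) : Plane) = V (π (σ x)) :=
    hσsmooth.continuousAt.eventually (by rwa [hσz])
  filter_upwards [hV', hsrc] with x hx hxs
  have hπσ : π (σ x) = x := hloc.localInverse_right_inv hxs
  have hchain : ∀ u : Plane, (mfderiv 𝓘(ℝ, ℂ) 𝓘(ℝ, Plane) π (σ x)
      (mfderiv 𝓘(ℝ, Plane) 𝓘(ℝ, ℂ) σ x u) : Plane) = u := by
    intro u
    have h1 := mfderiv_comp_apply x ((hπ.localDiffeo (σ x)).mdifferentiableAt (by simp))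
      ((hlocσ x hxs).mdifferentiableAt (by simp)) u
    have h2 : π ∘ σ =ᶠ[𝓝 x] id := by
      filter_upwards [σ.open_source.mem_nhds hxs] with y hy using hloc.localInverse_right_inv hy
    rw [h2.mfderiv_eq, mfderiv_id] at h1
    exact h1.symm
  -- The pullback applies the inverse of the differential of `σ`; by `hchain` this inverse is the
  -- differential of `π`.
  let e := (hlocσ x hxs).mfderivToContinuousLinearEquiv (by simp)
  have hpull : VectorField.mpullback 𝓘(ℝ, Plane) 𝓘(ℝ, ℂ) σ (UpperHalfPlane.vectorField f) x =
      e.symm (UpperHalfPlane.vectorField f (σ x)) :=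
    congrArg (fun L => L (UpperHalfPlane.vectorField f (σ x)))
      (ContinuousLinearMap.inverse_equiv e)
  have h4 : mfderiv 𝓘(ℝ, Plane) 𝓘(ℝ, ℂ) σ x (e.symm (UpperHalfPlane.vectorField f (σ x))) =
      UpperHalfPlane.vectorField f (σ x) := e.apply_symm_apply _
  have h3 := hchain (e.symm (UpperHalfPlane.vectorField f (σ x)))
  rw [h4, ← hpull] at h3
  have h5 : (V (π (σ x)) : Plane) = V x := congrArg (fun y => (V y : Plane)) hπσ
  exact congrArg (fun u => (⟨x, u⟩ : TangentBundle 𝓘(ℝ, Plane) S)) ((h5.symm.trans hx.symm).trans h3)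

end IsQuotientSurface

namespace PolarPolygon

theorem exists_mem_Ioo {n : ℕ} {P : PolarPolygon n} {z : ℂ} (hz : z ∈ interior P.domain)
    (h : ∀ k, ‖z‖ ≠ P.ρ k) : ∃ k : Fin n, ‖z‖ ∈ Ioo (P.ρ k.castSucc) (P.ρ k.succ) := by
  obtain ⟨k, hk⟩ := P.exists_mem_Ico (Ioo_subset_Ico_self (P.mem_interior_iff.1 hz).1)
  exact ⟨k, hk.1.lt_of_ne (h _).symm, hk.2⟩

end PolarPolygon

/-! ### The vector field on the surface -/

theorem lemma2p2 (p : ℕ) (hp : 1 < p)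
    (Γ : Subgroup SL(2, ℝ)) (hΓ : DiscreteTopology Γ)
    (P : PolarPolygon (2 * p - 1)) (hF : P.IsFundamentalDomainOf Γ) (A : P.SidePairing Γ)
    (S : Type*) [TopologicalSpace S] [T2Space S] [CompactSpace S] [ConnectedSpace S]
    [ChartedSpace Plane S] [IsManifold 𝓘(ℝ, Plane) ∞ S] (hS : HasGenus S p)
    (π : UpperHalfPlane → S) (hπ : IsQuotientSurface Γ π)
    (w : ℝ × ℝ → ℝ × ℝ) (hw : ContDiffOn ℝ ∞ w (interior P.rect))
    (hmatch : P.Matches A w) (hcusp : ∀ m ∈ P.cusps, w (P.phi m) = 0) :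
    ∃ V : (x : S) → TangentSpace 𝓘(ℝ, Plane) x,
      IsDefinedBy P π w V ∧
      (∀ V' : (x : S) → TangentSpace 𝓘(ℝ, Plane) x, IsDefinedBy P π w V' → V' = V) ∧
      (∀ z : UpperHalfPlane, (z : ℂ) ∈ P.cusps → V (π z) = 0) ∧
      ∀ z : UpperHalfPlane, (z : ℂ) ∈ interior P.domain → (∀ k, ‖(z : ℂ)‖ ≠ P.ρ k) →
        ContMDiffAt 𝓘(ℝ, Plane) 𝓘(ℝ, Plane).tangent ∞
          (fun x => (⟨x, V x⟩ : TangentBundle 𝓘(ℝ, Plane) S)) (π z) := by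
  have hn : 0 < 2 * p - 1 := by omega
  choose! v hv hvuniq using fun (z : ℂ) (hz : z ∈ P.domain) =>
    P.existsUnique_pushesTo hn hz (hcusp z)
  have hcons : ∀ z z' : UpperHalfPlane, (z : ℂ) ∈ P.domain → (z' : ℂ) ∈ P.domain → π z = π z' →
      (mfderiv 𝓘(ℝ, ℂ) 𝓘(ℝ, Plane) π z (v z) : Plane) =
        mfderiv 𝓘(ℝ, ℂ) 𝓘(ℝ, Plane) π z' (v z') := by
    intro z z' hz hz' hzz'
    obtain ⟨γ, hγ, rfl⟩ := (hπ.fibres z z').1 hzz'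
    rcases P.mem_domain_cases hz with h | ⟨s, h⟩ | h
    · rw [PolarPolygon.smul_eq_of_mem_interior hn hF hγ h hz']
    · rcases PolarPolygon.smul_eq_or_of_mem_side hn hF A h hγ hz' with h' | h'
      · rw [h']
      · rw [h'] at hz' ⊢
        -- By the matching condition `T_* (v z)` is a lift at `T • z`, hence it is the lift there;
        -- `π ∘ T = π` then gives equal images.
        rw [← hvuniq _ hz' _ (hmatch s z h (v z) (hv _ hz)), hπ.mfderiv_smul (A.T_mem s)]
    · have h1 := ((P.pushesTo_iff_of_mem_cusps h _ _).1 (hv _ hz)).1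
      have h2 := ((P.pushesTo_iff_of_mem_cusps
        (PolarPolygon.smul_mem_cusps hn hF A h hγ hz') _ _).1 (hv _ hz')).1
      rw [h1, h2]
      exact (map_zero (mfderiv 𝓘(ℝ, ℂ) 𝓘(ℝ, Plane) π z)).trans
        (map_zero (mfderiv 𝓘(ℝ, ℂ) 𝓘(ℝ, Plane) π (γ • z))).symm
  have hrep : ∀ x : S, ∃ z : UpperHalfPlane, (z : ℂ) ∈ P.domain ∧ π z = x := by
    intro x
    obtain ⟨z, rfl⟩ := hπ.surj x
    obtain ⟨γ, hγ, h⟩ := hF.1 z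
    exact ⟨γ • z, h, ((hπ.fibres _ _).2 ⟨γ, hγ, rfl⟩).symm⟩
  choose rep hrepD hrepπ using hrep
  -- By `hcons` the choice of representative is immaterial.
  let V : (x : S) → TangentSpace 𝓘(ℝ, Plane) x := fun x =>
    (mfderiv 𝓘(ℝ, ℂ) 𝓘(ℝ, Plane) π (rep x) (v (rep x)) : Plane)
  have hV : ∀ z : UpperHalfPlane, (z : ℂ) ∈ P.domain →
      (mfderiv 𝓘(ℝ, ℂ) 𝓘(ℝ, Plane) π z (v z) : Plane) = V (π z) := fun z hz =>
    hcons z _ hz (hrepD _) (hrepπ _).symm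
  refine ⟨V, fun z hz => ⟨v z, hV z hz, hv _ hz⟩, fun V' hV' => ?_, fun z hz => ?_,
    fun z hz hk => ?_⟩
  · funext x
    obtain ⟨z, hz, rfl⟩ : ∃ z : UpperHalfPlane, (z : ℂ) ∈ P.domain ∧ π z = x :=
      ⟨rep x, hrepD x, hrepπ x⟩
    obtain ⟨u, hu, hu'⟩ := hV' z hz
    rw [← hu, hvuniq _ hz u hu']
    exact hV z hz
  · rw [← hV z (P.cusps_subset hz), ((P.pushesTo_iff_of_mem_cusps hz _ _).1
      (hv _ (P.cusps_subset hz))).1]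
    exact map_zero (mfderiv 𝓘(ℝ, ℂ) 𝓘(ℝ, Plane) π z)
  · obtain ⟨k, hk⟩ := PolarPolygon.exists_mem_Ioo hz hk
    have hwz : ContDiffAt ℝ ∞ (fun y : ℂ => w (P.phi y)) z :=
      (hw.contDiffAt (isOpen_interior.mem_nhds (P.phi_mem_interior hz))).comp (z : ℂ)
        (P.contDiffAt_phi (interior_subset hz) hk)
    refine hπ.contMDiffAt_of_lift (P.contDiffAt_tangentPhiInv (interior_subset hz) hk hwz) ?_
    have hnorm : Continuous fun y : UpperHalfPlane => ‖(y : ℂ)‖ :=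
      UpperHalfPlane.continuous_coe.norm
    filter_upwards [(isOpen_interior.preimage UpperHalfPlane.continuous_coe).mem_nhds hz,
      hnorm.continuousAt.eventually (isOpen_Ioo.mem_nhds hk)] with y hy hyk
    -- Near `z` the chosen lift is the explicit inverse, hence smooth.
    rw [hvuniq _ (interior_subset hy) _ (P.pushesTo_tangentPhiInv hy hyk _)]
    exact hV y (interior_subset hy)
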